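/- For $R\in\mathbb{R}$ let $\Sigma_R$ be the three-dimensional space of constant curvature with scalar curvature $R$ (sectional curvature $K=R/6$): the sphere $S^3_r$ if $R=6/r^2>0$, Euclidean space if $R=0$, hyperbolic space $H^3_r$ if $R=-6/r^2<0$. In the Cayley–Klein–Hilbert (gnomonic) chart $\{x\in\mathbb{R}^3 : 1+K|x|^2>0\}$, in which geodesics are straight segments, its metric is $$g_x(u,v)=\frac{\langle u,v\rangle}{1+K|x|^2}-\frac{K\,\langle x,u\rangle\langle x,v\rangle}{(1+K|x|^2)^2}.$$ A (non-degenerate) regular geodesic tetrahedron of $\Sigma_R$, placed with its centre at the origin, is in this chart a Euclidean regular tetrahedron $T(s)$ centred at the origin, of Euclidean edge length $s>0$, with vertices in the chart. Let $a$ be the Riemannian length of its edges, $A(R,a)$ the Riemannian area of one of its faces, and $V(R,a)$ its Riemannian volume. For every $R$ the edge length $a$ determines $s$, and $a\mapsto A(R,a)$ is a bijection from the set of edge lengths of regular geodesic tetrahedra in $\Sigma_R$ onto $\{A>0 : |R|A<6\pi\}$. Let $a(R,A)$ be its inverse, and define $V(R,A)=V(R,a(R,A))$. Then for every fixed face area $A>0$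 the volume $V(R,A)$ is strictly increasing in the scalar curvature: for all real $R_1<R_2$ with $|R_1|A<6\pi$ and $|R_2|A<6\pi$, $$V(R_1,A)<V(R_2,A).$$ This remains true in the limiting case $R_2=6\pi/A$, where the regular tetrahedron of face area $A=\pi r^2$ degenerates to a half-sphere of $S^3_r$: for every $R$ with $|R|A<6\pi$, $V(R,A)$ is smaller than the volume of a half-sphere of $S^3_r$ with $r=\sqrt{A/\pi}$. -/

import Mathlib

open MeasureTheory Set Real

/-- The Riemannian metric, in the Cayley-Klein-Hilbert (gnomonic) coordinates `x ∈ ℝ³`, of the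
three-dimensional space of constant sectional curvature `K` (scalar curvature `6 * K`):
`g_x(u, v) = ⟨u, v⟩ / (1 + K|x|²) - K ⟨x, u⟩ ⟨x, v⟩ / (1 + K|x|²)²`.
With `r = 1 / √|K|`, it is the metric which the sphere `|X|² + X₄² = r²` in Euclidean space
(`K > 0`), respectively the hyperboloid `|X|² - X₄² = -r²` in Minkowski space (`K < 0`), acquires
from the parametrization `x ↦ (x, r) / √(1 + K|x|²)`; for `K = 0` it is the Euclidean metric.
Geodesics are the straight segments of the chart. -/
noncomputable def kleinMetric (K : ℝ) (x u v : EuclideanSpace ℝ (Fin 3)) : ℝ :=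
  inner ℝ u v / (1 + K * ‖x‖ ^ 2) - K * (inner ℝ x u * inner ℝ x v) / (1 + K * ‖x‖ ^ 2) ^ 2

/-- The range of the chart: all of `ℝ³` if `K ≥ 0` (an open half-sphere if `K > 0`), the open ball
of radius `r = 1 / √(-K)` if `K < 0` (all of hyperbolic space). -/
def kleinChart (K : ℝ) : Set (EuclideanSpace ℝ (Fin 3)) :=
  {x | 0 < 1 + K * ‖x‖ ^ 2}

/-- The `k`-dimensional Riemannian volume `√det (g_x(u i, u j))` of the parallelepiped spanned at
`x` by `u 0, …, u (k - 1)`. -/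
noncomputable def kleinDensity (K : ℝ) {k : ℕ} (x : EuclideanSpace ℝ (Fin 3))
    (u : Fin k → EuclideanSpace ℝ (Fin 3)) : ℝ :=
  √(Matrix.of fun i j => kleinMetric K x (u i) (u j)).det

/-- The simplex `{t ∈ ℝᵏ | t i ≥ 0, ∑ t i ≤ 1}` of affine parameters. -/
def parameterSimplex (k : ℕ) : Set (Fin k → ℝ) :=
  {t | (∀ i, 0 ≤ t i) ∧ ∑ i, t i ≤ 1}

/-- The `k`-dimensional Riemannian volume of the geodesic simplex with vertices `p 0, …, p k`
(a straight simplex in the chart): the integral of the induced volume element in the affine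
parametrization `t ↦ p 0 + ∑ t i (p (i + 1) - p 0)`. It is the length of a geodesic segment for
`k = 1`, the area of a geodesic triangle for `k = 2`, the volume of a geodesic tetrahedron for
`k = 3`. -/
noncomputable def geodesicSimplexVolume (K : ℝ) {k : ℕ}
    (p : Fin (k + 1) → EuclideanSpace ℝ (Fin 3)) : ℝ :=
  ∫ t in parameterSimplex k,
    kleinDensity K (p 0 + ∑ i : Fin k, t i • (p i.succ - p 0)) fun i => p i.succ - p 0

/-- The Riemannian volume of the whole chart; for `K > 0` this is the volume of a half-sphere. -/
noncomputable def kleinChartVolume (K : ℝ) : ℝ :=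
  ∫ x in kleinChart K, kleinDensity K x fun i : Fin 3 => EuclideanSpace.single i (1 : ℝ)

/-- The vertices, in the chart, of a regular geodesic tetrahedron centred at the origin; in the
Euclidean metric of the chart its edges have length `s`. -/
noncomputable def tetraVertex (s : ℝ) : Fin 4 → EuclideanSpace ℝ (Fin 3) :=
  ![!₂[-s / 2, -(√3 * s) / 6, -(√6 * s) / 12],
    !₂[s / 2, -(√3 * s) / 6, -(√6 * s) / 12],
    !₂[0, √3 * s / 3, -(√6 * s) / 12],
    !₂[0, 0, √6 * s / 4]]

/-- The coordinate edge lengths `s` for which the tetrahedron lies in the chart of the space of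
scalar curvature `R`. -/
def chartEdges (R : ℝ) : Set ℝ :=
  {s | 0 < s ∧ ∀ i, tetraVertex s i ∈ kleinChart (R / 6)}

/-- The geodesic edge length `a` of the tetrahedron of coordinate edge length `s`. -/
noncomputable def geodesicEdge (R s : ℝ) : ℝ :=
  geodesicSimplexVolume (R / 6) ![tetraVertex s 0, tetraVertex s 1]

/-- The geodesic edge lengths `a` of regular tetrahedra in the space of scalar curvature `R`. -/
def edgeLengths (R : ℝ) : Set ℝ :=
  geodesicEdge R '' chartEdges R

/-- The coordinate edge length of the tetrahedron of geodesic edge length `a`. -/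
noncomputable def chartEdge (R a : ℝ) : ℝ :=
  Function.invFunOn (geodesicEdge R) (chartEdges R) a

/-- The area `A(R, a)` of a face of the regular geodesic tetrahedron of geodesic edge length `a`
in the space of scalar curvature `R`. -/
noncomputable def tetraFaceArea (R a : ℝ) : ℝ :=
  geodesicSimplexVolume (R / 6)
    ![tetraVertex (chartEdge R a) 0, tetraVertex (chartEdge R a) 1, tetraVertex (chartEdge R a) 2]

/-- The volume `V(R, a)` of the regular geodesic tetrahedron of geodesic edge length `a` in the
space of scalar curvature `R`. -/
noncomputable def tetraVolume (R a : ℝ) : ℝ :=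
  geodesicSimplexVolume (R / 6) (tetraVertex (chartEdge R a))

/-- The edge length `a(R, A)` for which the faces have area `A`: the inverse of `a ↦ A(R, a)`. -/
noncomputable def edgeOfArea (R A : ℝ) : ℝ :=
  Function.invFunOn (tetraFaceArea R) (edgeLengths R) A

/-- The volume in terms of scalar curvature and face area, `V(R, A) = V(R, a(R, A))`. -/
noncomputable def tetraVolumeOfArea (R A : ℝ) : ℝ :=
  tetraVolume R (edgeOfArea R A)

/-! Write `K = R / 6`, let `h` be the inradius in the chart, `h ^ 2 = s ^ 2 / 24`, and `u = K * h ^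
2`. The length, area and volume densities of a regular simplex depend only on the sum of squares of
the barycentric coordinates. Cutting simplices into cones over their faces (`barySqIntegral_succ`)
therefore reduces face area and volume to `h ^ 2 * areaProfile u` and `h ^ 3 * volumeProfile u`,
both given by one-variable integrals.

Gauss–Bonnet, `mul_areaProfile`, says that `u * areaProfile u` is the angle excess `ε = K * A` of a
face, an explicit strictly increasing function of `u` from `(-1/9, ∞)` onto `(-π, π)`. Hence at
fixed `K` the area determines the tetrahedron, and by scaling `V = A ^ (3/2) * unitAreaVolume (K *
A)`. It remains to show that `unitAreaVolume` is strictly increasing.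

For this, let the tetrahedron grow by homotheties of the chart at fixed `K`, and take the face area
of the growing tetrahedron as variable. The derivative of `V` with respect to `A ^ (3/2)` is a
constant times `slopeProfile`, evaluated at the current excess `y * ε`, where `y` is the fraction of
area reached (`volumeProfile_eq`). The slope is a product of monotone factors, one of them strictly
so (`slopeProfile_strictMonoOn`), so the integrand increases strictly with `ε`, for positive and for
negative curvature alike.

For the half-sphere, a tetrahedron in positive curvature lies in the chart, whose volume therefore
bounds its own. Letting `ε` tend to `π` turns this into the required bound, and monotonicity makes
it strict (`unitAreaVolume_lt`). -/

/-! ### Integration over a simplex by cones from its barycentre -/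

/-- The barycentric coordinates `(1 - ∑ t i, t 0, …, t (k - 1))`. -/
def baryCoord {k : ℕ} (t : Fin k → ℝ) : Fin (k + 1) → ℝ :=
  Fin.cons (1 - ∑ i, t i) t

/-- The sum of the squares of the barycentric coordinates. -/
def barySq {k : ℕ} (t : Fin k → ℝ) : ℝ :=
  (1 - ∑ i, t i) ^ 2 + ∑ i, t i ^ 2

/-- The integral over the parameter simplex of a function of the sum of the squares of the
barycentric coordinates. -/
noncomputable def barySqIntegral (k : ℕ) (F : ℝ → ℝ) : ℝ :=
  ∫ t in parameterSimplex k, F (barySq t)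

/-- The part of the parameter simplex where the `i`-th barycentric coordinate is minimal. -/
def minRegion {k : ℕ} (i : Fin (k + 1)) : Set (Fin k → ℝ) :=
  {t ∈ parameterSimplex k | ∀ j, baryCoord t i ≤ baryCoord t j}

lemma continuous_barySq {k : ℕ} : Continuous (barySq (k := k)) := by
  unfold barySq; fun_prop

lemma continuous_baryCoord {k : ℕ} (i : Fin (k + 1)) :
    Continuous fun t : Fin k → ℝ => baryCoord t i := by
  refine Fin.cases ?_ (fun j => ?_) i <;> simp only [baryCoord, Fin.cons_zero, Fin.cons_succ] <;>
    fun_prop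

lemma isClosed_parameterSimplex (k : ℕ) : IsClosed (parameterSimplex k) := by
  have : parameterSimplex k = (⋂ i, {t | 0 ≤ t i}) ∩ {t | ∑ i, t i ≤ 1} := by
    ext t; simp [parameterSimplex]
  rw [this]
  refine (isClosed_iInter fun i => ?_).inter ?_
  · exact isClosed_le continuous_const (continuous_apply i)
  · exact isClosed_le (by fun_prop) continuous_const

lemma isCompact_parameterSimplex (k : ℕ) : IsCompact (parameterSimplex k) := by
  refine (isCompact_univ_pi fun _ : Fin k => isCompact_Icc (a := (0 : ℝ)) (b := 1)).of_isClosed_subset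
    (isClosed_parameterSimplex k) fun t ht i _ => ⟨ht.1 i, ?_⟩
  exact (Finset.single_le_sum (fun j _ => ht.1 j) (Finset.mem_univ i)).trans ht.2

lemma isClosed_minRegion {k : ℕ} (i : Fin (k + 1)) : IsClosed (minRegion i) := by
  have : minRegion i = parameterSimplex k ∩ ⋂ j, {t | baryCoord t i ≤ baryCoord t j} := by
    ext t; simp [minRegion]
  rw [this]
  exact (isClosed_parameterSimplex k).inter
    (isClosed_iInter fun j => isClosed_le (continuous_baryCoord i) (continuous_baryCoord j))

lemma iUnion_minRegion (k : ℕ) : ⋃ i, minRegion (k := k) i = parameterSimplex k := by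
  ext t
  simp only [mem_iUnion, minRegion, mem_ofPred_eq]
  constructor
  · rintro ⟨_, h, _⟩; exact h
  · intro h
    obtain ⟨i, hi⟩ := Finite.exists_min (baryCoord t)
    exact ⟨i, h, hi⟩

lemma exists_baryCoord_vertex {k : ℕ} (i : Fin (k + 1)) :
    ∃ t : Fin k → ℝ, baryCoord t i = 1 ∧ ∀ j, j ≠ i → baryCoord t j = 0 := by
  refine Fin.cases ⟨0, by simp [baryCoord], fun j hj => ?_⟩ (fun m => ⟨Pi.single m 1, ?_, ?_⟩) i
  · obtain ⟨l, rfl⟩ := Fin.exists_succ_eq.2 hj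
    simp [baryCoord]
  · simp [baryCoord]
  · intro j hj
    revert hj
    refine Fin.cases (fun _ => by simp [baryCoord]) (fun l hl => ?_) j
    have : l ≠ m := fun h => hl (by rw [h])
    simp [baryCoord, this]

/-- The set is a proper affine subspace: the `i`-th vertex is not in it. -/
lemma volume_baryCoord_eq {k : ℕ} {i j : Fin (k + 1)} (hij : i ≠ j) :
    volume {t : Fin k → ℝ | baryCoord t i = baryCoord t j} = 0 := by
  let A : AffineSubspace ℝ (Fin k → ℝ) :=
    { carrier := {t | baryCoord t i = baryCoord t j}
      smul_vsub_vadd_mem' := by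
        have key : ∀ (l : Fin (k + 1)) (c : ℝ) (p q r : Fin k → ℝ),
            baryCoord (c • (p - q) + r) l =
              c * (baryCoord p l - baryCoord q l) + baryCoord r l := by
          intro l c p q r
          refine Fin.cases ?_ (fun m => ?_) l
          · simp only [baryCoord, Fin.cons_zero, Pi.add_apply, Pi.smul_apply, Pi.sub_apply,
              smul_eq_mul, Finset.sum_add_distrib, ← Finset.mul_sum, Finset.sum_sub_distrib]
            ring
          · simp [baryCoord]
        intro c p q r hp hq hr
        simp only [mem_ofPred_eq, vsub_eq_sub, vadd_eq_add] at *
        rw [key, key, hp, hq, hr] }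
  have hne : A ≠ ⊤ := by
    intro h
    have hA : ∀ t : Fin k → ℝ, baryCoord t i = baryCoord t j := fun t => by
      have : t ∈ A := h ▸ AffineSubspace.mem_top ℝ _ t
      exact this
    obtain ⟨t, h1, h2⟩ := exists_baryCoord_vertex i
    have := hA t
    rw [h1, h2 j hij.symm] at this
    exact one_ne_zero this
  exact Measure.addHaar_affineSubspace volume A hne

lemma integral_parameterSimplex_eq_sum {k : ℕ} {f : (Fin k → ℝ) → ℝ}
    (hf : IntegrableOn f (parameterSimplex k)) :
    ∫ t in parameterSimplex k, f t = ∑ i, ∫ t in minRegion i, f t := by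
  rw [← iUnion_minRegion, integral_iUnion_ae
    (fun i => (isClosed_minRegion i).measurableSet.nullMeasurableSet) ?_
    (by rwa [iUnion_minRegion]), tsum_fintype]
  intro i j hij
  refine measure_mono_null ?_ (volume_baryCoord_eq hij)
  exact fun t ht => le_antisymm (ht.1.2 j) (ht.2.2 i)

lemma barySq_insertNth {k : ℕ} (i : Fin (k + 1)) (r : ℝ) (y : Fin k → ℝ) :
    barySq (i.insertNth r y : Fin (k + 1) → ℝ) =
      (1 - (r + ∑ j, y j)) ^ 2 + (r ^ 2 + ∑ j, y j ^ 2) := by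
  simp [barySq, Fin.sum_univ_succAbove _ i]

lemma insertNth_mem_minRegion {k : ℕ} (i : Fin (k + 1)) (r : ℝ) (y : Fin k → ℝ) :
    (i.insertNth r y : Fin (k + 1) → ℝ) ∈ minRegion i.succ ↔
      0 ≤ r ∧ (∀ j, r ≤ y j) ∧ r ≤ 1 - (r + ∑ j, y j) := by
  have hall : ∀ P : Fin (k + 1) → Prop, (∀ j, P j) ↔ P i ∧ ∀ j, P (i.succAbove j) :=
    fun P => Fin.forall_iff_succAbove i
  have hsucc : ∀ P : Fin (k + 2) → Prop, (∀ j, P j) ↔ P 0 ∧ ∀ j : Fin (k + 1), P j.succ :=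
    fun P => Fin.forall_fin_succ
  simp only [minRegion, parameterSimplex, mem_ofPred_eq, hsucc, hall, baryCoord, Fin.cons_succ,
    Fin.cons_zero, Fin.insertNth_apply_same, Fin.insertNth_apply_succAbove,
    Fin.sum_univ_succAbove _ i]
  constructor
  · rintro ⟨⟨⟨h1, -⟩, -⟩, h2, -, h3⟩
    exact ⟨h1, h3, h2⟩
  · rintro ⟨h1, h2, h3⟩
    exact ⟨⟨⟨h1, fun j => h1.trans (h2 j)⟩, by linarith⟩, h3, le_rfl, h2⟩

/-- The slice of the cone at this height is the opposite face shrunk by `τ` towards its own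
barycentre: the other coordinates are `(1 - τ) / (k + 2) + τ * z j`, with `z` in the face. This
gives the Jacobian `τ ^ k`, and expanding the squares gives the new argument of `F`. -/
lemma integral_slice {k : ℕ} (F : ℝ → ℝ) (i : Fin (k + 1)) {τ : ℝ} (h0 : 0 < τ) (h1 : τ ≤ 1) :
    ∫ y : Fin k → ℝ, (minRegion i.succ).indicator (fun t => F (barySq t))
        (i.insertNth ((1 - τ) / (k + 2)) y : Fin (k + 1) → ℝ) =
      τ ^ k * barySqIntegral k fun q => F ((1 - τ ^ 2) / (k + 2) + τ ^ 2 * q) := by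
  set r : ℝ := (1 - τ) / (k + 2) with hr
  have hk : (0 : ℝ) < k + 2 := by positivity
  have hτ : τ = 1 - (k + 2) * r := by rw [hr]; field_simp; ring
  have hr0 : 0 ≤ r := by rw [hr]; exact div_nonneg (by linarith) hk.le
  set g : (Fin k → ℝ) → ℝ := fun y => (minRegion i.succ).indicator (fun t => F (barySq t))
        (i.insertNth r y : Fin (k + 1) → ℝ) with hg
  have e1 : ∫ y, g y = ∫ y, g ((fun _ => r) + y) := (integral_add_left_eq_self g _).symm
  have e2 := Measure.integral_comp_smul (μ := volume) (fun y => g ((fun _ => r) + y)) τ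
  rw [Module.finrank_fin_fun, abs_of_pos (by positivity), smul_eq_mul] at e2
  have e3 : ∫ y, g y = τ ^ k * ∫ z : Fin k → ℝ, g ((fun _ => r) + τ • z) := by
    rw [e2, e1, ← mul_assoc, mul_inv_cancel₀ (by positivity), one_mul]
  rw [e3, barySqIntegral, ← integral_indicator (isClosed_parameterSimplex k).measurableSet]
  congr 1
  refine integral_congr_ae (Filter.Eventually.of_forall fun z => ?_)
  show g ((fun _ => r) + τ • z) = _
  have hs : ∑ j, ((fun _ => r) + τ • z : Fin k → ℝ) j = k * r + τ * ∑ j, z j := by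
    simp [Finset.sum_add_distrib, Finset.mul_sum]
  have hs2 : ∑ j, ((fun _ => r) + τ • z : Fin k → ℝ) j ^ 2 =
      k * r ^ 2 + 2 * r * τ * ∑ j, z j + τ ^ 2 * ∑ j, z j ^ 2 := by
    simp [Finset.sum_add_distrib, Finset.mul_sum, add_sq, mul_pow, mul_assoc]
  have hmem : (i.insertNth r ((fun _ => r) + τ • z) : Fin (k + 1) → ℝ) ∈ minRegion i.succ ↔
      z ∈ parameterSimplex k := by
    rw [insertNth_mem_minRegion, hs]
    simp only [Pi.add_apply, Pi.smul_apply, smul_eq_mul, parameterSimplex, mem_ofPred_eq,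
      le_add_iff_nonneg_right, mul_nonneg_iff_of_pos_left h0, hr0, true_and]
    refine and_congr_right fun _ => ?_
    rw [show r ≤ 1 - (r + (k * r + τ * ∑ j, z j)) ↔ τ * ∑ j, z j ≤ τ * 1 by
      rw [mul_one]; constructor <;> intro h <;> nlinarith]
    exact mul_le_mul_iff_right₀ h0
  by_cases hz : z ∈ parameterSimplex k
  · rw [hg]
    simp only []
    rw [indicator_of_mem (hmem.2 hz), indicator_of_mem hz, barySq_insertNth, hs, hs2]
    congr 1
    unfold barySq
    rw [hτ]
    field_simp
    rw [hτ] at hr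
    generalize (∑ j, z j ^ 2) = b
    generalize (∑ j, z j) = a
    ring
  · rw [hg]
    simp only []
    rw [indicator_of_notMem (mt hmem.1 hz), indicator_of_notMem hz]

lemma integral_minRegion_succ {k : ℕ} {F : ℝ → ℝ}
    (hF : IntegrableOn (fun t => F (barySq t)) (parameterSimplex (k + 1))) (i : Fin (k + 1)) :
    ∫ t in minRegion i.succ, F (barySq t) = (k + 2 : ℝ)⁻¹ *
      ∫ τ in 0..1, τ ^ k * barySqIntegral k fun q => F ((1 - τ ^ 2) / (k + 2) + τ ^ 2 * q) := by
  have hk : (0 : ℝ) < k + 2 := by positivity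
  have hm := (isClosed_minRegion i.succ).measurableSet
  set f := (minRegion i.succ).indicator (fun t : Fin (k + 1) → ℝ => F (barySq t)) with hf
  have hfi : Integrable f :=
    (integrable_indicator_iff hm).2 (hF.mono_set fun t ht => ht.1)
  have mp := (volume_preserving_piFinSuccAbove (fun _ : Fin (k + 1) => ℝ) i).symm
  have e1 : ∫ t in minRegion i.succ, F (barySq t) =
      ∫ r : ℝ, ∫ y : Fin k → ℝ, f (i.insertNth r y : Fin (k + 1) → ℝ) := by
    rw [← integral_indicator hm, ← hf, ← mp.integral_comp' f, Measure.volume_eq_prod,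
      integral_prod]
    · rfl
    · exact (mp.integrable_comp_emb (MeasurableEquiv.measurableEmbedding _)).2 hfi
  set H : ℝ → ℝ := fun r => ∫ y : Fin k → ℝ, f (i.insertNth r y : Fin (k + 1) → ℝ) with hH
  -- The smallest of `k + 2` nonnegative numbers with sum `1` lies between `0` and `1 / (k + 2)`;
  -- other slices are empty.
  have e2 : ∫ r, H r = ∫ r in 0..(1 / (k + 2) : ℝ), H r := by
    rw [intervalIntegral.integral_of_le (by positivity), ← integral_Icc_eq_integral_Ioc,
      setIntegral_eq_integral_of_forall_compl_eq_zero]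
    intro r hr
    refine integral_eq_zero_of_ae (Filter.Eventually.of_forall fun y => ?_)
    refine indicator_of_notMem (fun h => hr ?_) _
    rw [insertNth_mem_minRegion] at h
    obtain ⟨h1, h2, h3⟩ := h
    have := Finset.sum_le_sum fun j (_ : j ∈ Finset.univ) => h2 j
    simp only [Finset.sum_const, Finset.card_univ, Fintype.card_fin, nsmul_eq_mul] at this
    refine ⟨h1, ?_⟩
    rw [le_div_iff₀ hk]
    linarith
  rw [e1, e2]
  have e3 := intervalIntegral.integral_comp_sub_mul H (c := (k + 2 : ℝ)⁻¹) (a := 0) (b := 1)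
    (by positivity) (k + 2 : ℝ)⁻¹
  rw [mul_one, sub_self, mul_zero, sub_zero, inv_inv, smul_eq_mul] at e3
  rw [one_div, eq_inv_mul_iff_mul_eq₀ hk.ne', ← e3]
  refine intervalIntegral.integral_congr_ae (Filter.Eventually.of_forall fun τ hτ => ?_)
  rw [uIoc_of_le zero_le_one] at hτ
  rw [← integral_slice F i hτ.1 hτ.2, show (k + 2 : ℝ)⁻¹ - (k + 2 : ℝ)⁻¹ * τ = (1 - τ) / (k + 2) by
    rw [div_eq_inv_mul]; ring]

/-- The affine reflection exchanging the first two barycentric coordinates. -/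
def barySwap {k : ℕ} (t : Fin (k + 1) → ℝ) : Fin (k + 1) → ℝ :=
  Fin.cons (1 - ∑ i, t i) (Fin.tail t)

/-- With the other coordinates fixed, the map is a reflection of the first coordinate, so Fubini
applies. -/
lemma measurePreserving_barySwap (k : ℕ) : MeasurePreserving (barySwap (k := k)) := by
  have mp := volume_preserving_piFinSuccAbove (fun _ : Fin (k + 1) => ℝ) 0
  have sw : MeasurePreserving
      (fun p : (Fin k → ℝ) × ℝ => (p.1, (1 - ∑ i, p.1 i) - p.2)) := by
    refine (MeasurePreserving.id volume).skew_product (g := fun (y : Fin k → ℝ) r => (1 - ∑ i, y i) - r)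
      (by unfold Function.uncurry; fun_prop) (Filter.Eventually.of_forall fun y => ?_)
    exact (Measure.measurePreserving_sub_left volume _).map_eq
  have h := mp.symm.comp ((Measure.measurePreserving_swap.comp sw).comp
    (Measure.measurePreserving_swap.comp mp))
  convert h using 1
  ext t j
  simp only [barySwap, Function.comp_apply, MeasurableEquiv.piFinSuccAbove_symm_apply]
  refine Fin.cases ?_ (fun j => ?_) j
  · simp [Fin.sum_univ_succ, MeasurableEquiv.piFinSuccAbove]
    simp only [Fin.tail]
    ring
  · simp [Fin.tail, MeasurableEquiv.piFinSuccAbove]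

lemma barySwap_barySwap {k : ℕ} (t : Fin (k + 1) → ℝ) : barySwap (barySwap t) = t := by
  ext j
  refine Fin.cases ?_ (fun j => ?_) j
  · simp [barySwap, Fin.sum_univ_succ, Fin.tail]
    ring
  · simp [barySwap, Fin.tail]

lemma baryCoord_barySwap {k : ℕ} (t : Fin (k + 1) → ℝ) (i : Fin (k + 2)) :
    baryCoord (barySwap t) i = baryCoord t (Equiv.swap 0 1 i) := by
  refine Fin.cases ?_ (Fin.cases ?_ fun j => ?_) i
  · rw [Equiv.swap_apply_left, ← Fin.succ_zero_eq_one]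
    simp [baryCoord, barySwap, Fin.sum_univ_succ, Fin.tail]
    ring
  · simp [baryCoord, barySwap, Fin.sum_univ_succ, Fin.tail]
  · rw [Equiv.swap_apply_of_ne_of_ne (Fin.succ_ne_zero _)
      (by rw [← Fin.succ_zero_eq_one, Ne, Fin.succ_inj]; exact Fin.succ_ne_zero _)]
    simp [baryCoord, barySwap, Fin.tail]

lemma mem_parameterSimplex_iff {k : ℕ} (t : Fin k → ℝ) :
    t ∈ parameterSimplex k ↔ ∀ i, 0 ≤ baryCoord t i := by
  simp [parameterSimplex, Fin.forall_fin_succ, baryCoord, and_comm]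

lemma barySq_eq_sum {k : ℕ} (t : Fin k → ℝ) : barySq t = ∑ i, baryCoord t i ^ 2 := by
  simp [barySq, Fin.sum_univ_succ, baryCoord]

lemma barySq_barySwap {k : ℕ} (t : Fin (k + 1) → ℝ) : barySq (barySwap t) = barySq t := by
  simp only [barySq_eq_sum, baryCoord_barySwap]
  exact Equiv.sum_comp (Equiv.swap 0 1) fun i => baryCoord t i ^ 2

lemma barySwap_preimage_minRegion {k : ℕ} :
    barySwap ⁻¹' minRegion (0 : Fin (k + 2)) = minRegion (Fin.succ 0) := by
  ext t
  simp only [mem_preimage, minRegion, mem_ofPred_eq, mem_parameterSimplex_iff, baryCoord_barySwap,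
    Equiv.swap_apply_left, Fin.succ_zero_eq_one]
  refine and_congr ?_ ?_
  · exact (Equiv.swap (0 : Fin (k + 2)) 1).forall_congr_left.trans (by simp)
  · exact (Equiv.swap (0 : Fin (k + 2)) 1).forall_congr_left.trans (by simp)

/-- The zeroth barycentric coordinate is not a coordinate of the parameter space, so slicing does
not reach its cone directly; the symmetry `barySwap` carries that cone to another one. -/
lemma integral_minRegion_zero {k : ℕ} (F : ℝ → ℝ) :
    ∫ t in minRegion (0 : Fin (k + 2)), F (barySq t) =
      ∫ t in minRegion (Fin.succ (0 : Fin (k + 1))), F (barySq t) := by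
  have hinj : Function.Involutive (barySwap (k := k)) := barySwap_barySwap
  let e : (Fin (k + 1) → ℝ) ≃ᵐ (Fin (k + 1) → ℝ) :=
    { toEquiv := hinj.toPerm
      measurable_toFun := (measurePreserving_barySwap k).measurable
      measurable_invFun := (measurePreserving_barySwap k).measurable }
  have h := (measurePreserving_barySwap k).setIntegral_preimage_emb e.measurableEmbedding
    (fun t => F (barySq t)) (minRegion (0 : Fin (k + 2)))
  rw [← h, barySwap_preimage_minRegion]
  simp only [barySq_barySwap]

/-- A function of the sum of the squares of the barycentric coordinates is integrated over a
simplex by decomposing it into cones over its faces with apex the barycentre. -/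
theorem barySqIntegral_succ {k : ℕ} {F : ℝ → ℝ}
    (hF : IntegrableOn (fun t => F (barySq t)) (parameterSimplex (k + 1))) :
    barySqIntegral (k + 1) F = ∫ τ in 0..1,
      τ ^ k * barySqIntegral k fun q => F ((1 - τ ^ 2) / (k + 2) + τ ^ 2 * q) := by
  rw [barySqIntegral, integral_parameterSimplex_eq_sum hF, Fin.sum_univ_succ,
    integral_minRegion_zero]
  simp only [integral_minRegion_succ hF, Finset.sum_const, Finset.card_univ, Fintype.card_fin,
    nsmul_eq_mul]
  push_cast
  field_simp
  ring

lemma barySqIntegral_zero (F : ℝ → ℝ) : barySqIntegral 0 F = F 1 := by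
  have : parameterSimplex 0 = univ := by
    ext t; simp [parameterSimplex]
  simp [barySqIntegral, this, barySq, integral_unique, Measure.real, volume_pi]

lemma barySq_mem_Icc {k : ℕ} {t : Fin k → ℝ} (ht : t ∈ parameterSimplex k) :
    barySq t ∈ Icc (1 / (k + 1) : ℝ) 1 := by
  rw [mem_parameterSimplex_iff] at ht
  have hs : ∑ i, baryCoord t i = 1 := by simp [Fin.sum_univ_succ, baryCoord]
  rw [barySq_eq_sum]
  constructor
  · have := sq_sum_le_card_mul_sum_sq (s := Finset.univ) (f := baryCoord t)
    rw [hs] at this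
    simp only [Finset.card_univ, Fintype.card_fin] at this
    rw [div_le_iff₀ (by positivity)]
    push_cast at this
    linarith
  · calc ∑ i, baryCoord t i ^ 2 ≤ ∑ i, baryCoord t i := by
          refine Finset.sum_le_sum fun i _ => ?_
          have h1 : baryCoord t i ≤ 1 :=
            hs ▸ Finset.single_le_sum (fun j _ => ht j) (Finset.mem_univ i)
          nlinarith [ht i]
      _ = 1 := hs

lemma integrableOn_barySq {k : ℕ} {F : ℝ → ℝ} (hF : ContinuousOn F (Icc (1 / (k + 1) : ℝ) 1)) :
    IntegrableOn (fun t => F (barySq t)) (parameterSimplex k) :=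
  (hF.comp continuous_barySq.continuousOn fun _ ht => barySq_mem_Icc ht).integrableOn_compact
    (isCompact_parameterSimplex k)

/-! ### Densities of regular simplices -/

/-- `p` consists of vertices of a regular tetrahedron with barycentre `0` and edge length `s`. -/
def IsRegularVertices {k : ℕ} (s : ℝ) (p : Fin (k + 1) → EuclideanSpace ℝ (Fin 3)) : Prop :=
  ∀ i j, inner ℝ (p i) (p j) = s ^ 2 / 2 * ((if i = j then 1 else 0) - 1 / 4)

lemma isRegularVertices_tetraVertex (s : ℝ) : IsRegularVertices s (tetraVertex s) := by
  have h3 : √3 ^ 2 = (3 : ℝ) := Real.sq_sqrt (by norm_num)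
  have h6 : √6 ^ 2 = (6 : ℝ) := Real.sq_sqrt (by norm_num)
  intro i j
  fin_cases i <;> fin_cases j <;>
    simp [tetraVertex, PiLp.inner_apply, EuclideanSpace.norm_sq_eq, Fin.sum_univ_three] <;> ring_nf <;>
    (try simp only [h3, h6]) <;> ring

lemma IsRegularVertices.comp {k l : ℕ} {s : ℝ} {p : Fin (k + 1) → EuclideanSpace ℝ (Fin 3)}
    (hp : IsRegularVertices s p) {f : Fin (l + 1) → Fin (k + 1)} (hf : Function.Injective f) :
    IsRegularVertices s (p ∘ f) := by
  intro i j
  simp only [Function.comp_apply, hp _ _, hf.eq_iff]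

section Regular

variable {k : ℕ} {s : ℝ} {p : Fin (k + 1) → EuclideanSpace ℝ (Fin 3)}

lemma simplexPoint_eq_sum (p : Fin (k + 1) → EuclideanSpace ℝ (Fin 3)) (t : Fin k → ℝ) :
    p 0 + ∑ i : Fin k, t i • (p i.succ - p 0) = ∑ j, baryCoord t j • p j := by
  simp only [Fin.sum_univ_succ, baryCoord, Fin.cons_zero, Fin.cons_succ, smul_sub,
    Finset.sum_sub_distrib, sub_smul, one_smul, Finset.sum_smul]
  abel

lemma sum_baryCoord (t : Fin k → ℝ) : ∑ j, baryCoord t j = 1 := by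
  simp [Fin.sum_univ_succ, baryCoord]

lemma IsRegularVertices.inner_point (hp : IsRegularVertices s p) (t : Fin k → ℝ)
    (l : Fin (k + 1)) :
    inner ℝ (∑ j, baryCoord t j • p j) (p l) = s ^ 2 / 2 * (baryCoord t l - 1 / 4) := by
  simp only [sum_inner, real_inner_smul_left, hp _ _]
  have : ∀ j, baryCoord t j * (s ^ 2 / 2 * ((if j = l then 1 else 0) - 1 / 4)) =
      s ^ 2 / 2 * ((if j = l then baryCoord t j else 0) - 1 / 4 * baryCoord t j) := by
    intro j; split_ifs <;> ring
  simp only [this, ← Finset.mul_sum, Finset.sum_sub_distrib, sum_baryCoord]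
  simp

/-- This is why `barySq` is the only variable: the conformal factor `1 + K * ‖x‖ ^ 2` becomes `1 + u
* (12 * barySq t - 3)`. -/
lemma IsRegularVertices.norm_sq_point (hp : IsRegularVertices s p) (t : Fin k → ℝ) :
    ‖∑ j, baryCoord t j • p j‖ ^ 2 = s ^ 2 / 2 * (barySq t - 1 / 4) := by
  rw [← real_inner_self_eq_norm_sq]
  conv_lhs => rw [inner_sum]
  simp only [real_inner_smul_right, hp.inner_point]
  have : ∀ j, baryCoord t j * (s ^ 2 / 2 * (baryCoord t j - 1 / 4)) =
      s ^ 2 / 2 * (baryCoord t j ^ 2 - 1 / 4 * baryCoord t j) := by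
    intro j; ring
  simp only [this, ← Finset.mul_sum, Finset.sum_sub_distrib, sum_baryCoord, barySq_eq_sum, mul_one]

lemma IsRegularVertices.inner_edge (hp : IsRegularVertices s p) (i j : Fin k) :
    inner ℝ (p i.succ - p 0) (p j.succ - p 0) = s ^ 2 / 2 * ((if i = j then 1 else 0) + 1) := by
  simp only [inner_sub_left, inner_sub_right, hp _ _, Fin.succ_inj, Fin.succ_ne_zero,
    (Fin.succ_ne_zero _).symm, if_true, if_false]
  ring

/-- The metric coefficients in the affine parametrization, `u = K s² / 24`. -/
lemma IsRegularVertices.kleinMetric_edge (hp : IsRegularVertices s p) {K u : ℝ}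
    (hu : u = K * (s ^ 2 / 24)) (t : Fin k → ℝ) (i j : Fin k) :
    kleinMetric K (p 0 + ∑ i : Fin k, t i • (p i.succ - p 0)) (p i.succ - p 0) (p j.succ - p 0) =
      s ^ 2 / 2 * (((if i = j then 1 else 0) + 1) / (1 + u * (12 * barySq t - 3)) -
        12 * u * ((t i - (1 - ∑ l, t l)) * (t j - (1 - ∑ l, t l))) /
          (1 + u * (12 * barySq t - 3)) ^ 2) := by
  rw [simplexPoint_eq_sum, kleinMetric, hp.inner_edge, hp.norm_sq_point]
  simp only [inner_sub_right, hp.inner_point]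
  rw [show 1 + K * (s ^ 2 / 2 * (barySq t - 1 / 4)) = 1 + u * (12 * barySq t - 3) by
    rw [hu]; ring]
  simp only [baryCoord, Fin.cons_succ, Fin.cons_zero]
  generalize 1 + u * (12 * barySq t - 3) = w
  rw [hu]
  ring

end Regular

lemma weight_pos {u q : ℝ} (hu : -1 / 9 < u) (hq : q ∈ Icc (1 / 4 : ℝ) 1) :
    0 < 1 + u * (12 * q - 3) := by
  obtain ⟨h1, h2⟩ := hq
  nlinarith [mul_nonneg (sub_nonneg.2 h1) (by linarith : (0 : ℝ) ≤ u + 1 / 9)]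

/-- In dimensions one, two and three the density is the Euclidean one times `√(1 + K * d ^ 2) / w ^
((k + 1) / 2)`, where `w` is the conformal factor and `d` the distance of the affine hull from the
origin. Here `d ^ 2 = 3 * s ^ 2 / 24` for an edge, `s ^ 2 / 24` for a face and `0` for the solid,
which explains the factors `1 + 3 * u`, `1 + u` and `1`. -/
lemma IsRegularVertices.kleinDensity_one {s : ℝ} (hs : 0 ≤ s)
    {p : Fin 2 → EuclideanSpace ℝ (Fin 3)} (hp : IsRegularVertices s p) {K u : ℝ}
    (hu : u = K * (s ^ 2 / 24)) {t : Fin 1 → ℝ} (hw : 0 < 1 + u * (12 * barySq t - 3)) :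
    kleinDensity K (p 0 + ∑ i : Fin 1, t i • (p i.succ - p 0)) (fun i => p i.succ - p 0) =
      s * √(1 + 3 * u) / (1 + u * (12 * barySq t - 3)) := by
  rw [kleinDensity]
  simp only [hp.kleinMetric_edge hu]
  have hq : barySq t = (1 - t 0) ^ 2 + t 0 ^ 2 := by simp [barySq]
  simp only [Matrix.det_fin_one, Matrix.of_apply, if_true, Fin.sum_univ_one]
  generalize hwd : 1 + u * (12 * barySq t - 3) = w at *
  rw [show s ^ 2 / 2 * ((1 + 1) / w - 12 * u * ((t 0 - (1 - t 0)) * (t 0 - (1 - t 0))) / w ^ 2) =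
      (s / w) ^ 2 * (1 + 3 * u) by
    rw [hq] at hwd; field_simp; rw [← hwd]; ring,
    Real.sqrt_mul (by positivity), Real.sqrt_sq (by positivity)]
  ring

lemma IsRegularVertices.kleinDensity_two {s : ℝ}
    {p : Fin 3 → EuclideanSpace ℝ (Fin 3)} (hp : IsRegularVertices s p) {K u : ℝ}
    (hu : u = K * (s ^ 2 / 24)) {t : Fin 2 → ℝ} (hw : 0 < 1 + u * (12 * barySq t - 3)) :
    kleinDensity K (p 0 + ∑ i : Fin 2, t i • (p i.succ - p 0)) (fun i => p i.succ - p 0) =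
      √3 / 2 * s ^ 2 * √(1 + u) *
        (1 / ((1 + u * (12 * barySq t - 3)) * √(1 + u * (12 * barySq t - 3)))) := by
  rw [kleinDensity]
  simp only [hp.kleinMetric_edge hu]
  have hq : barySq t = (1 - (t 0 + t 1)) ^ 2 + (t 0 ^ 2 + t 1 ^ 2) := by
    simp [barySq, Fin.sum_univ_two]
  simp only [Matrix.det_fin_two, Matrix.of_apply, if_true, Fin.sum_univ_two, Fin.isValue,
    zero_ne_one, one_ne_zero, if_false]
  generalize hwd : 1 + u * (12 * barySq t - 3) = w at *
  trans √((s ^ 2 / (2 * w)) ^ 2 * (3 * (1 + u) / w))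
  · congr 1
    rw [hq] at hwd
    field_simp
    rw [← hwd]
    ring
  · rw [Real.sqrt_mul (by positivity), Real.sqrt_sq (by positivity), Real.sqrt_div' _ hw.le,
      Real.sqrt_mul (by norm_num)]
    field_simp

lemma IsRegularVertices.kleinDensity_three {s : ℝ} (hs : 0 ≤ s)
    {p : Fin 4 → EuclideanSpace ℝ (Fin 3)} (hp : IsRegularVertices s p) {K u : ℝ}
    (hu : u = K * (s ^ 2 / 24)) {t : Fin 3 → ℝ} (hw : 0 < 1 + u * (12 * barySq t - 3)) :
    kleinDensity K (p 0 + ∑ i : Fin 3, t i • (p i.succ - p 0)) (fun i => p i.succ - p 0) =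
      s ^ 3 / √2 * (1 / (1 + u * (12 * barySq t - 3)) ^ 2) := by
  rw [kleinDensity]
  simp only [hp.kleinMetric_edge hu]
  have hq : barySq t = (1 - (t 0 + t 1 + t 2)) ^ 2 + (t 0 ^ 2 + t 1 ^ 2 + t 2 ^ 2) := by
    simp [barySq, Fin.sum_univ_three]
  simp only [Matrix.det_fin_three, Matrix.of_apply, if_true, Fin.sum_univ_three, Fin.isValue,
    zero_ne_one, one_ne_zero, if_false, show (0 : Fin 3) ≠ 2 by decide,
    show (1 : Fin 3) ≠ 2 by decide, show (2 : Fin 3) ≠ 0 by decide,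
    show (2 : Fin 3) ≠ 1 by decide]
  generalize hwd : 1 + u * (12 * barySq t - 3) = w at *
  rw [show s ^ 3 / √2 * (1 / w ^ 2) = √((s ^ 3 / w ^ 2) ^ 2 / 2) by
    rw [Real.sqrt_div (by positivity), Real.sqrt_sq (by positivity)]; field_simp]
  congr 1
  rw [hq] at hwd
  field_simp
  rw [← hwd]
  ring

/-! ### One-variable integrals for length, area and volume -/

lemma one_add_mul_pos {u c : ℝ} (hu : -1 / 9 < u) (h1 : 0 ≤ c) (h2 : c ≤ 9) : 0 < 1 + u * c := by
  nlinarith [mul_nonneg h1 (by linarith : (0 : ℝ) ≤ u + 1 / 9)]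

lemma sq_mem_unit {x : ℝ} (hx : x ∈ Icc (0 : ℝ) 1) : x ^ 2 ∈ Icc (0 : ℝ) 1 :=
  ⟨sq_nonneg x, pow_le_one₀ hx.1 hx.2⟩

lemma edgeDenom_pos {u ρ : ℝ} (hu : -1 / 9 < u) (hρ : ρ ∈ Icc (0 : ℝ) 1) :
    0 < 1 + 3 * u + 6 * u * ρ ^ 2 := by
  have := one_add_mul_pos hu (c := 3 + 6 * ρ ^ 2) (by positivity) (by linarith [(sq_mem_unit hρ).2])
  linarith

/-- Half the integral of the length density of an edge, up to an elementary factor. -/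
noncomputable def edgeProfile (u : ℝ) : ℝ :=
  ∫ ρ in 0..1, 1 / (1 + 3 * u + 6 * u * ρ ^ 2)

/-- The ratio of the area of a face and the square of the inradius, as a function of the curvature
times the square of the inradius. -/
noncomputable def areaProfile (u : ℝ) : ℝ :=
  12 * √3 * ∫ ρ in 0..1, 1 / (√(1 + 3 * u + 6 * u * ρ ^ 2) *
    (√(1 + u) + √(1 + 3 * u + 6 * u * ρ ^ 2)))

/-- The ratio of the volume and the cube of the inradius, as a function of the curvature
times the square of the inradius. -/
noncomputable def volumeProfile (u : ℝ) : ℝ :=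
  24 * √3 * ∫ τ in 0..1, τ ^ 2 * (edgeProfile (u * τ ^ 2) / (1 + u * τ ^ 2))

lemma intervalIntegral_unit_congr {f g : ℝ → ℝ} (h : ∀ x ∈ Icc (0 : ℝ) 1, f x = g x) :
    ∫ x in 0..1, f x = ∫ x in 0..1, g x :=
  intervalIntegral.integral_congr fun x hx => h x (by rwa [uIcc_of_le zero_le_one] at hx)

lemma barySqIntegral_one {F : ℝ → ℝ} (hF : ContinuousOn F (Icc (1 / 2) 1)) :
    barySqIntegral 1 F = ∫ ρ in 0..1, F ((1 + ρ ^ 2) / 2) := by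
  rw [barySqIntegral_succ (integrableOn_barySq (by norm_num; simpa using hF))]
  simp only [barySqIntegral_zero]
  refine intervalIntegral_unit_congr fun ρ _ => ?_
  rw [pow_zero, one_mul]
  congr 1
  push_cast
  ring

lemma barySqIntegral_two {F : ℝ → ℝ} (hF : ContinuousOn F (Icc (1 / 3) 1)) :
    barySqIntegral 2 F =
      ∫ σ in 0..1, σ * ∫ ρ in 0..1, F (1 / 3 + σ ^ 2 * (1 + 3 * ρ ^ 2) / 6) := by
  rw [barySqIntegral_succ (integrableOn_barySq (by norm_num; simpa using hF))]
  refine intervalIntegral_unit_congr fun σ hσ => ?_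
  rw [pow_one, barySqIntegral_one]
  · congr 1
    refine intervalIntegral_unit_congr fun ρ _ => ?_
    congr 1
    push_cast
    ring
  · refine hF.comp (by fun_prop) fun q hq => ?_
    obtain ⟨h1, h2⟩ := sq_mem_unit hσ
    obtain ⟨h3, h4⟩ := hq
    push_cast
    constructor <;> nlinarith

lemma intervalIntegral_unit_swap {G : ℝ → ℝ → ℝ}
    (hG : ContinuousOn (Function.uncurry G) (Icc 0 1 ×ˢ Icc 0 1)) :
    ∫ x in 0..1, ∫ y in 0..1, G x y = ∫ y in 0..1, ∫ x in 0..1, G x y := by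
  refine intervalIntegral_intervalIntegral_swap ?_
  rw [uIoc_of_le zero_le_one]
  exact (hG.integrableOn_compact (isCompact_Icc.prod isCompact_Icc)).mono_set
    (prod_mono Ioc_subset_Icc_self Ioc_subset_Icc_self)

lemma faceDenom_pos {u σ ρ : ℝ} (hu : -1 / 9 < u) (hσ : σ ∈ Icc (0 : ℝ) 1)
    (hρ : ρ ∈ Icc (0 : ℝ) 1) : 0 < 1 + u + 2 * u * (1 + 3 * ρ ^ 2) * σ ^ 2 := by
  obtain ⟨h1, h2⟩ := sq_mem_unit hσ
  obtain ⟨h3, h4⟩ := sq_mem_unit hρ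
  have := one_add_mul_pos hu (c := 1 + 2 * (1 + 3 * ρ ^ 2) * σ ^ 2) (by positivity) (by nlinarith)
  linarith

/-- Two cone decompositions give a radial variable `σ` in the face and a variable `ρ` along half an
edge. The order is exchanged so that the radial integral, which is elementary, comes first. -/
lemma barySqIntegral_two_weight {u : ℝ} (hu : -1 / 9 < u) {f : ℝ → ℝ}
    (hf : ContinuousOn f (Ioi 0)) :
    barySqIntegral 2 (fun q => f (1 + u * (12 * q - 3))) =
      ∫ ρ in 0..1, ∫ σ in 0..1, σ * f (1 + u + 2 * u * (1 + 3 * ρ ^ 2) * σ ^ 2) := by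
  rw [barySqIntegral_two]
  · rw [← intervalIntegral_unit_swap (G := fun σ ρ =>
      σ * f (1 + u + 2 * u * (1 + 3 * ρ ^ 2) * σ ^ 2))]
    · refine intervalIntegral_unit_congr fun σ _ => ?_
      rw [← intervalIntegral.integral_const_mul]
      refine intervalIntegral_unit_congr fun ρ _ => ?_
      congr 2
      ring
    · refine ContinuousOn.mul (by fun_prop) (hf.comp (by fun_prop) ?_)
      rintro ⟨σ, ρ⟩ ⟨hσ, hρ⟩
      exact faceDenom_pos hu hσ hρ
  · refine hf.comp (by fun_prop) fun q hq => weight_pos hu ⟨by linarith [hq.1], hq.2⟩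

/-- The primitive `-1 / (B * √(A + B * σ ^ 2))`, normalised to vanish at `0` and rationalised, no
longer has `B` in the denominator, so that the flat case `B = 0` is included. -/
lemma integral_rpow_neg_three_halves {A B : ℝ} (h : ∀ σ ∈ Icc (0 : ℝ) 1, 0 < A + B * σ ^ 2) :
    ∫ σ in 0..1, σ * (1 / ((A + B * σ ^ 2) * √(A + B * σ ^ 2))) =
      1 / (√A * √(A + B) * (√A + √(A + B))) := by
  have hA : 0 < A := by simpa using h 0 (by simp)
  have hd : ∀ σ ∈ uIcc (0 : ℝ) 1, HasDerivAt
      (fun σ => σ ^ 2 / (√A * √(A + B * σ ^ 2) * (√A + √(A + B * σ ^ 2))))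
      (σ * (1 / ((A + B * σ ^ 2) * √(A + B * σ ^ 2)))) σ := by
    intro σ hσ
    rw [uIcc_of_le zero_le_one] at hσ
    have hw := h σ hσ
    have hs := Real.sqrt_pos.2 hw
    have ha := Real.sqrt_pos.2 hA
    have h1 : HasDerivAt (fun σ => √(A + B * σ ^ 2)) ((B * (2 * σ)) / (2 * √(A + B * σ ^ 2))) σ := by
      have := (((hasDerivAt_pow 2 σ).const_mul B).const_add A).sqrt hw.ne'
      simpa using this
    have h2 := (hasDerivAt_pow 2 σ).div ((h1.const_mul √A).mul (h1.const_add √A))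
      (by simp only [Pi.mul_apply]; positivity)
    refine h2.congr_deriv ?_
    have e1 : B * σ ^ 2 = √(A + B * σ ^ 2) ^ 2 - √A ^ 2 := by
      rw [Real.sq_sqrt hw.le, Real.sq_sqrt hA.le]; ring
    have e2 : A + B * σ ^ 2 = √(A + B * σ ^ 2) ^ 2 := (Real.sq_sqrt hw.le).symm
    rw [show (A + B * σ ^ 2) * √(A + B * σ ^ 2) = √(A + B * σ ^ 2) ^ 2 * √(A + B * σ ^ 2) by
      rw [← e2]]
    simp only [Pi.mul_apply]
    generalize √(A + B * σ ^ 2) = y at *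
    generalize √A = a at *
    field_simp
    push_cast
    simp only [pow_one]
    linear_combination (-σ * (2 * y + a)) * e1
  rw [intervalIntegral.integral_eq_sub_of_hasDerivAt hd]
  · simp
  · refine ContinuousOn.intervalIntegrable fun σ hσ => ?_
    rw [uIcc_of_le zero_le_one] at hσ
    have hw := h σ hσ
    refine ContinuousAt.continuousWithinAt ?_
    have : (A + B * σ ^ 2) * √(A + B * σ ^ 2) ≠ 0 := by positivity
    fun_prop (disch := assumption)

lemma integral_inv_sq {A B : ℝ} (h : ∀ σ ∈ Icc (0 : ℝ) 1, 0 < A + B * σ ^ 2) :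
    ∫ σ in 0..1, σ * (1 / (A + B * σ ^ 2) ^ 2) = 1 / (2 * A) * (1 / (A + B)) := by
  have hA : 0 < A := by simpa using h 0 (by simp)
  have hd : ∀ σ ∈ uIcc (0 : ℝ) 1, HasDerivAt (fun σ => σ ^ 2 / (2 * A * (A + B * σ ^ 2)))
      (σ * (1 / (A + B * σ ^ 2) ^ 2)) σ := by
    intro σ hσ
    rw [uIcc_of_le zero_le_one] at hσ
    have hw := h σ hσ
    have h2 := (hasDerivAt_pow 2 σ).div
      ((((hasDerivAt_pow 2 σ).const_mul B).const_add A).const_mul (2 * A)) (by positivity)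
    refine h2.congr_deriv ?_
    field_simp
    push_cast
    ring
  rw [intervalIntegral.integral_eq_sub_of_hasDerivAt hd]
  · simp; ring
  · refine ContinuousOn.intervalIntegrable fun σ hσ => ?_
    rw [uIcc_of_le zero_le_one] at hσ
    have hw := h σ hσ
    refine ContinuousAt.continuousWithinAt ?_
    have : (A + B * σ ^ 2) ^ 2 ≠ 0 := by positivity
    fun_prop (disch := assumption)

lemma barySqIntegral_area {u : ℝ} (hu : -1 / 9 < u) :
    12 * √3 * √(1 + u) * barySqIntegral 2 (fun q =>
      1 / ((1 + u * (12 * q - 3)) * √(1 + u * (12 * q - 3)))) = areaProfile u := by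
  rw [barySqIntegral_two_weight hu (f := fun w => 1 / (w * √w)), areaProfile, mul_assoc,
    ← intervalIntegral.integral_const_mul]
  · congr 1
    refine intervalIntegral_unit_congr fun ρ hρ => ?_
    have h1 : 0 < √(1 + u) := Real.sqrt_pos.2 (by linarith)
    have h2 := Real.sqrt_pos.2 (edgeDenom_pos hu hρ)
    rw [integral_rpow_neg_three_halves fun σ hσ => faceDenom_pos hu hσ hρ,
      show 1 + u + 2 * u * (1 + 3 * ρ ^ 2) = 1 + 3 * u + 6 * u * ρ ^ 2 by ring]
    field_simp
  · intro w hw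
    rw [mem_Ioi] at hw
    have : w * √w ≠ 0 := by positivity
    exact ContinuousAt.continuousWithinAt (by fun_prop (disch := assumption))

lemma continuousOn_inv_sq : ContinuousOn (fun w : ℝ => 1 / w ^ 2) (Ioi 0) := by
  intro w hw
  rw [mem_Ioi] at hw
  have : w ^ 2 ≠ 0 := by positivity
  exact ContinuousAt.continuousWithinAt (by fun_prop (disch := assumption))

/-- This is the volume density integrated over a face, not the area density: it is what a cone of
the solid contributes per slice. -/
lemma barySqIntegral_face {u : ℝ} (hu : -1 / 9 < u) :
    barySqIntegral 2 (fun q => 1 / (1 + u * (12 * q - 3)) ^ 2) =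
      edgeProfile u / (2 * (1 + u)) := by
  rw [barySqIntegral_two_weight hu (f := fun w => 1 / w ^ 2) continuousOn_inv_sq, edgeProfile,
    div_eq_inv_mul, ← one_div, ← intervalIntegral.integral_const_mul]
  refine intervalIntegral_unit_congr fun ρ hρ => ?_
  rw [integral_inv_sq fun σ hσ => faceDenom_pos hu hσ hρ]
  congr 2
  ring

lemma mul_sq_gt {u τ : ℝ} (hu : -1 / 9 < u) (hτ : τ ∈ Icc (0 : ℝ) 1) : -1 / 9 < u * τ ^ 2 := by
  obtain ⟨h1, h2⟩ := sq_mem_unit hτ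
  nlinarith [mul_nonneg h1 (by linarith : (0 : ℝ) ≤ u + 1 / 9)]

lemma barySqIntegral_volume {u : ℝ} (hu : -1 / 9 < u) :
    48 * √3 * barySqIntegral 3 (fun q => 1 / (1 + u * (12 * q - 3)) ^ 2) = volumeProfile u := by
  rw [barySqIntegral_succ, volumeProfile,
    show (48 : ℝ) * √3 = 24 * √3 * 2 by ring, mul_assoc (24 * √3),
    ← intervalIntegral.integral_const_mul]
  · congr 1
    refine intervalIntegral_unit_congr fun τ hτ => ?_
    have e : ∀ q : ℝ, 1 + u * (12 * ((1 - τ ^ 2) / ((2 : ℕ) + 2) + τ ^ 2 * q) - 3) =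
        1 + u * τ ^ 2 * (12 * q - 3) := by
      intro q; push_cast; ring
    simp only [e]
    rw [barySqIntegral_face (mul_sq_gt hu hτ)]
    have : 0 < 1 + u * τ ^ 2 := by linarith [mul_sq_gt hu hτ]
    field_simp
  · refine integrableOn_barySq (k := 3) (F := fun q => 1 / (1 + u * (12 * q - 3)) ^ 2)
      (continuousOn_inv_sq.comp (f := fun q => 1 + u * (12 * q - 3)) (by fun_prop) fun q hq => ?_)
    exact weight_pos hu ⟨by have := hq.1; push_cast at this; linarith, hq.2⟩

lemma barySqIntegral_edge {u : ℝ} (hu : -1 / 9 < u) :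
    barySqIntegral 1 (fun q => 1 / (1 + u * (12 * q - 3))) = edgeProfile u := by
  rw [barySqIntegral_one, edgeProfile]
  · refine intervalIntegral_unit_congr fun ρ _ => ?_
    congr 1
    ring
  · intro q hq
    have := (weight_pos hu (q := q) ⟨by linarith [hq.1], hq.2⟩).ne'
    exact ContinuousAt.continuousWithinAt (by fun_prop (disch := assumption))

section Regular

variable {s : ℝ} {K u : ℝ}

lemma setIntegral_kleinDensity {k : ℕ} {p : Fin (k + 1) → EuclideanSpace ℝ (Fin 3)} {c : ℝ}
    {F : ℝ → ℝ} (h : ∀ t ∈ parameterSimplex k,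
      kleinDensity K (p 0 + ∑ i : Fin k, t i • (p i.succ - p 0)) (fun i => p i.succ - p 0) =
        c * F (barySq t)) :
    geodesicSimplexVolume K p = c * barySqIntegral k F := by
  rw [geodesicSimplexVolume, barySqIntegral, ← integral_const_mul]
  exact setIntegral_congr_fun (isClosed_parameterSimplex k).measurableSet h

lemma weight_pos_of_mem {k : ℕ} (hk : k ≤ 3) (hu : -1 / 9 < u) {t : Fin k → ℝ}
    (ht : t ∈ parameterSimplex k) : 0 < 1 + u * (12 * barySq t - 3) := by
  obtain ⟨h1, h2⟩ := barySq_mem_Icc ht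
  refine weight_pos hu ⟨le_trans ?_ h1, h2⟩
  have : (k : ℝ) ≤ 3 := by exact_mod_cast hk
  rw [div_le_div_iff₀ (by norm_num) (by positivity)]
  linarith

lemma IsRegularVertices.length_eq (hs : 0 ≤ s) {p : Fin 2 → EuclideanSpace ℝ (Fin 3)}
    (hp : IsRegularVertices s p) (hu : u = K * (s ^ 2 / 24)) (hu' : -1 / 9 < u) :
    geodesicSimplexVolume K p = s * √(1 + 3 * u) * edgeProfile u := by
  rw [← barySqIntegral_edge hu']
  refine setIntegral_kleinDensity fun t ht => ?_
  rw [hp.kleinDensity_one hs hu (weight_pos_of_mem (by norm_num) hu' ht), mul_one_div]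

lemma IsRegularVertices.area_eq {p : Fin 3 → EuclideanSpace ℝ (Fin 3)}
    (hp : IsRegularVertices s p) (hu : u = K * (s ^ 2 / 24)) (hu' : -1 / 9 < u) :
    geodesicSimplexVolume K p = s ^ 2 / 24 * areaProfile u := by
  rw [← barySqIntegral_area hu', setIntegral_kleinDensity (F := fun q =>
    1 / ((1 + u * (12 * q - 3)) * √(1 + u * (12 * q - 3)))) fun t ht =>
    hp.kleinDensity_two hu (weight_pos_of_mem (by norm_num) hu' ht)]
  ring

lemma IsRegularVertices.volume_eq (hs : 0 ≤ s) {p : Fin 4 → EuclideanSpace ℝ (Fin 3)}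
    (hp : IsRegularVertices s p) (hu : u = K * (s ^ 2 / 24)) (hu' : -1 / 9 < u) :
    geodesicSimplexVolume K p = √(s ^ 2 / 24) ^ 3 * volumeProfile u := by
  rw [← barySqIntegral_volume hu', setIntegral_kleinDensity
    (F := fun q => 1 / (1 + u * (12 * q - 3)) ^ 2) fun t ht =>
    hp.kleinDensity_three hs hu (weight_pos_of_mem (by norm_num) hu' ht), ← mul_assoc]
  congr 1
  rw [Real.sqrt_div (by positivity), Real.sqrt_sq hs, show (24 : ℝ) = 2 ^ 2 * 2 * 3 by norm_num,
    Real.sqrt_mul (by norm_num), Real.sqrt_mul (by norm_num), Real.sqrt_sq (by norm_num)]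
  have h2 : √2 ^ 2 = (2 : ℝ) := Real.sq_sqrt (by norm_num)
  have h3 : √3 ^ 2 = (3 : ℝ) := Real.sq_sqrt (by norm_num)
  have : √2 ≠ 0 := by positivity
  have : √3 ≠ 0 := by positivity
  field_simp
  rw [h2, h3]
  ring

end Regular

/-! ### Gauss–Bonnet for the faces -/

/-- The sum of the three angles of a face minus `π`, as a function of the curvature times the
square of the inradius. -/
noncomputable def angleExcess (u : ℝ) : ℝ :=
  2 * π - 6 * arctan √(3 * (1 + u) / (1 + 9 * u))

/-- The derivative of `angleExcess`. -/
noncomputable def angleExcessDeriv (u : ℝ) : ℝ :=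
  6 * √3 / ((1 + 3 * u) * √((1 + 9 * u) * (1 + u)))

lemma hasDerivAt_div_sqrt {b c ρ : ℝ} (h : 0 < b + c * ρ ^ 2) :
    HasDerivAt (fun ρ => ρ / √(b + c * ρ ^ 2)) (b / ((b + c * ρ ^ 2) * √(b + c * ρ ^ 2))) ρ := by
  have hs := Real.sqrt_pos.2 h
  have h1 : HasDerivAt (fun ρ => √(b + c * ρ ^ 2)) ((c * (2 * ρ)) / (2 * √(b + c * ρ ^ 2))) ρ := by
    have := (((hasDerivAt_pow 2 ρ).const_mul c).const_add b).sqrt h.ne'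
    simpa using this
  refine ((hasDerivAt_id ρ).div h1 hs.ne').congr_deriv ?_
  have e2 : √(b + c * ρ ^ 2) ^ 2 = b + c * ρ ^ 2 := Real.sq_sqrt h.le
  simp only [id]
  rw [e2]
  field_simp
  rw [e2]
  ring

lemma areaProfile_integrand_continuousOn {u : ℝ} (hu : -1 / 9 < u) :
    ContinuousOn (fun ρ => 1 / (√(1 + 3 * u + 6 * u * ρ ^ 2) *
      (√(1 + u) + √(1 + 3 * u + 6 * u * ρ ^ 2)))) (Icc 0 1) := by
  intro ρ hρ
  have h1 := Real.sqrt_pos.2 (edgeDenom_pos hu hρ)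
  have : √(1 + 3 * u + 6 * u * ρ ^ 2) * (√(1 + u) + √(1 + 3 * u + 6 * u * ρ ^ 2)) ≠ 0 := by
    positivity
  exact ContinuousAt.continuousWithinAt (by fun_prop (disch := assumption))

lemma intervalIntegrable_unit {f : ℝ → ℝ} (h : ContinuousOn f (Icc 0 1)) :
    IntervalIntegrable f volume 0 1 :=
  ContinuousOn.intervalIntegrable (by rwa [uIcc_of_le zero_le_one])

lemma areaProfile_pos {u : ℝ} (hu : -1 / 9 < u) : 0 < areaProfile u := by
  refine mul_pos (by positivity) (intervalIntegral.intervalIntegral_pos_of_pos_on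
    (intervalIntegrable_unit (areaProfile_integrand_continuousOn hu)) (fun ρ hρ => ?_) zero_lt_one)
  have h1 := Real.sqrt_pos.2 (edgeDenom_pos hu (Ioo_subset_Icc_self hρ))
  positivity

lemma areaProfile_antitoneOn : AntitoneOn areaProfile (Ioi (-1 / 9)) := by
  intro u hu v hv huv
  refine mul_le_mul_of_nonneg_left ?_ (by positivity)
  refine intervalIntegral.integral_mono_on zero_le_one
    (intervalIntegrable_unit (areaProfile_integrand_continuousOn hv))
    (intervalIntegrable_unit (areaProfile_integrand_continuousOn hu)) fun ρ hρ => ?_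
  have h1 := Real.sqrt_pos.2 (edgeDenom_pos hu hρ)
  gcongr

lemma areaProfile_zero : areaProfile 0 = 6 * √3 := by
  simp [areaProfile]; norm_num; ring_nf

lemma angleExcessDeriv_zero : angleExcessDeriv 0 = 6 * √3 := by
  simp [angleExcessDeriv]

lemma arctan_sqrt_three_eq : arctan √3 = π / 3 := by
  rw [← Real.tan_pi_div_three, Real.arctan_tan] <;> linarith [Real.pi_pos]

/-- Gauss–Bonnet: curvature times area is the angle excess. The factor `u` cancels against a
difference of two square roots, after which the integrand has a primitive made of two arctangents.
-/
lemma mul_areaProfile {u : ℝ} (hu : -1 / 9 < u) : u * areaProfile u = angleExcess u := by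
  have hA : 0 < 1 + u := by linarith
  have hA' := Real.sqrt_pos.2 hA
  have h3 : 0 < √(3 : ℝ) := by positivity
  have h3' : √(3 : ℝ) ^ 2 = 3 := Real.sq_sqrt (by norm_num)
  have hd : ∀ ρ ∈ uIcc (0 : ℝ) 1, HasDerivAt
      (fun ρ => 6 * arctan (√3 * ρ) -
        6 * arctan (√3 * √(1 + u) * (ρ / √(1 + 3 * u + 6 * u * ρ ^ 2))))
      (u * (12 * √3) * (1 / (√(1 + 3 * u + 6 * u * ρ ^ 2) *
        (√(1 + u) + √(1 + 3 * u + 6 * u * ρ ^ 2))))) ρ := by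
    intro ρ hρ
    rw [uIcc_of_le zero_le_one] at hρ
    have hB := edgeDenom_pos hu hρ
    have hB' := Real.sqrt_pos.2 hB
    have hb : 0 < 1 + 3 * u := by linarith
    refine ((((hasDerivAt_id ρ).const_mul √3).arctan.const_mul 6).sub
      (((hasDerivAt_div_sqrt hB).const_mul (√3 * √(1 + u))).arctan.const_mul 6)).congr_deriv ?_
    have e1 : √(1 + u) ^ 2 = 1 + u := Real.sq_sqrt hA.le
    have e2 : √(1 + 3 * u + 6 * u * ρ ^ 2) ^ 2 = 1 + 3 * u + 6 * u * ρ ^ 2 := Real.sq_sqrt hB.le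
    simp only [id, mul_pow, div_pow, h3', e1, e2]
    rw [show 1 + 3 * (1 + u) * (ρ ^ 2 / (1 + 3 * u + 6 * u * ρ ^ 2)) =
      (1 + 3 * u) * (1 + 3 * ρ ^ 2) / (1 + 3 * u + 6 * u * ρ ^ 2) by
        rw [eq_div_iff hB.ne', add_mul, mul_assoc (3 * (1 + u)), div_mul_cancel₀ _ hB.ne']; ring]
    have e3 : √(1 + 3 * u + 6 * u * ρ ^ 2) ^ 2 - √(1 + u) ^ 2 = 2 * u * (1 + 3 * ρ ^ 2) := by
      rw [e1, e2]; ring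
    generalize hBdef : 1 + 3 * u + 6 * u * ρ ^ 2 = B at *
    generalize √(1 + u) = a at *
    generalize √B = y at *
    field_simp
    linear_combination 6 * e3
  have hi := intervalIntegral.integral_eq_sub_of_hasDerivAt hd
    (((intervalIntegrable_unit (areaProfile_integrand_continuousOn hu))).const_mul _)
  rw [intervalIntegral.integral_const_mul] at hi
  rw [areaProfile, ← mul_assoc, hi, angleExcess, mul_one, arctan_sqrt_three_eq,
    Real.sqrt_div (by positivity), Real.sqrt_mul (by norm_num)]
  norm_num
  rw [show 1 + 3 * u + 6 * u = 1 + 9 * u by ring, div_eq_mul_inv]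
  ring_nf

lemma ratio_pos {u : ℝ} (hu : -1 / 9 < u) : 0 < 3 * (1 + u) / (1 + 9 * u) :=
  div_pos (by linarith) (by linarith)

lemma hasDerivAt_angleExcess {u : ℝ} (hu : -1 / 9 < u) :
    HasDerivAt angleExcess (angleExcessDeriv u) u := by
  have h1 : 0 < 1 + u := by linarith
  have h9 : 0 < 1 + 9 * u := by linarith
  have h3 : 0 < 1 + 3 * u := by linarith
  have hq : HasDerivAt (fun u : ℝ => 3 * (1 + u) / (1 + 9 * u)) (-24 / (1 + 9 * u) ^ 2) u := by
    refine ((((hasDerivAt_id u).const_add 1).const_mul 3).div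
      (((hasDerivAt_id u).const_mul 9).const_add 1) h9.ne').congr_deriv ?_
    simp only [id]
    congr 1
    ring
  refine (((hq.sqrt (ratio_pos hu).ne').arctan.const_mul 6).const_sub (2 * π)).congr_deriv ?_
  rw [angleExcessDeriv, Real.sq_sqrt (ratio_pos hu).le, Real.sqrt_div (by positivity),
    Real.sqrt_mul (by norm_num), Real.sqrt_mul h9.le]
  have e1 : √(1 + u) ^ 2 = 1 + u := Real.sq_sqrt h1.le
  have e9 : √(1 + 9 * u) ^ 2 = 1 + 9 * u := Real.sq_sqrt h9.le
  have e3 : √(3 : ℝ) ^ 2 = 3 := Real.sq_sqrt (by norm_num)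
  have p1 := Real.sqrt_pos.2 h1
  have p9 := Real.sqrt_pos.2 h9
  have p3 : 0 < √(3 : ℝ) := by positivity
  rw [show 1 + 3 * (1 + u) / (1 + 9 * u) = 4 * (1 + 3 * u) / (1 + 9 * u) by
    rw [eq_div_iff h9.ne', add_mul, div_mul_cancel₀ _ h9.ne']; ring]
  nth_rewrite 1 2 [← e9]
  generalize √(1 + 9 * u) = y at *
  generalize √(1 + u) = a at *
  field_simp
  rw [e3]
  ring

lemma angleExcess_strictMonoOn : StrictMonoOn angleExcess (Ioi (-1 / 9)) := by
  intro u hu v hv huv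
  rw [mem_Ioi] at hu hv
  have : √(3 * (1 + v) / (1 + 9 * v)) < √(3 * (1 + u) / (1 + 9 * u)) := by
    refine Real.sqrt_lt_sqrt (ratio_pos hv).le ?_
    rw [div_lt_div_iff₀ (by linarith) (by linarith)]
    nlinarith
  have := Real.arctan_strictMono this
  rw [angleExcess, angleExcess]
  linarith

lemma angleExcess_zero : angleExcess 0 = 0 := by
  rw [← mul_areaProfile (by norm_num), zero_mul]

/-- The ratio under the root runs through `(1/3, ∞)`, hence the arctangent through `(π/6, π/2)`. -/
lemma angleExcess_mem {u : ℝ} (hu : -1 / 9 < u) : angleExcess u ∈ Ioo (-π) π := by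
  have h1 := Real.arctan_lt_pi_div_two √(3 * (1 + u) / (1 + 9 * u))
  have h2 : arctan (1 / √3) < arctan √(3 * (1 + u) / (1 + 9 * u)) := by
    refine Real.arctan_strictMono ?_
    rw [show 1 / √(3 : ℝ) = √(1 / 3) by rw [Real.sqrt_div zero_le_one, Real.sqrt_one]]
    refine Real.sqrt_lt_sqrt (by norm_num) ?_
    rw [div_lt_div_iff₀ (by norm_num) (by linarith)]
    linarith
  rw [← Real.tan_pi_div_six, Real.arctan_tan (by linarith [Real.pi_pos])
    (by linarith [Real.pi_pos])] at h2
  constructor <;> rw [angleExcess] <;> linarith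

/-- The inverse of `angleExcess`. -/
noncomputable def excessInverse (ε : ℝ) : ℝ :=
  (3 - tan ((2 * π - ε) / 6) ^ 2) / (9 * tan ((2 * π - ε) / 6) ^ 2 - 3)

lemma excessInverse_spec {ε : ℝ} (hε : ε ∈ Ioo (-π) π) :
    -1 / 9 < excessInverse ε ∧ angleExcess (excessInverse ε) = ε := by
  obtain ⟨h1, h2⟩ := hε
  have ht : tan (π / 6) < tan ((2 * π - ε) / 6) :=
    Real.tan_lt_tan_of_nonneg_of_lt_pi_div_two (by positivity) (by linarith) (by linarith)
  rw [Real.tan_pi_div_six] at ht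
  have h0 : 0 < 1 / √(3 : ℝ) := by positivity
  have hq : 1 / 3 < tan ((2 * π - ε) / 6) ^ 2 := by
    have := pow_lt_pow_left₀ ht h0.le two_ne_zero
    rwa [div_pow, Real.sq_sqrt (by norm_num), one_pow] at this
  have hpos : 0 < 9 * tan ((2 * π - ε) / 6) ^ 2 - 3 := by linarith
  -- The definition of `excessInverse` solves this equation for `u`.
  have e : 3 * (1 + excessInverse ε) / (1 + 9 * excessInverse ε) = tan ((2 * π - ε) / 6) ^ 2 := by
    rw [excessInverse]
    generalize tan ((2 * π - ε) / 6) ^ 2 = q at *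
    rw [show 1 + 9 * ((3 - q) / (9 * q - 3)) = 24 / (9 * q - 3) by
      rw [eq_div_iff hpos.ne', add_mul, mul_assoc, div_mul_cancel₀ _ hpos.ne']; ring,
      show 1 + (3 - q) / (9 * q - 3) = 8 * q / (9 * q - 3) by
      rw [eq_div_iff hpos.ne', add_mul, div_mul_cancel₀ _ hpos.ne']; ring,
      ← mul_div_assoc, div_div_div_cancel_right₀ hpos.ne']
    ring
  constructor
  · rw [excessInverse, div_lt_div_iff₀ (by norm_num) hpos]
    linarith
  · rw [angleExcess, e, Real.sqrt_sq (h0.trans ht).le, Real.arctan_tan (by linarith) (by linarith)]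
    ring

lemma excessInverse_angleExcess {u : ℝ} (hu : -1 / 9 < u) : excessInverse (angleExcess u) = u :=
  have h := excessInverse_spec (angleExcess_mem hu)
  angleExcess_strictMonoOn.injOn h.1 hu h.2

lemma excessInverse_strictMonoOn : StrictMonoOn excessInverse (Ioo (-π) π) := by
  intro ε hε δ hδ h
  have h1 := excessInverse_spec hε
  have h2 := excessInverse_spec hδ
  rw [← angleExcess_strictMonoOn.lt_iff_lt h1.1 h2.1, h1.2, h2.2]
  exact h

/-! ### Monotonicity of the slope -/

lemma edgeProfile_integrand_continuousOn {u : ℝ} (hu : -1 / 9 < u) :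
    ContinuousOn (fun ρ => 1 / (1 + 3 * u + 6 * u * ρ ^ 2)) (Icc 0 1) := by
  intro ρ hρ
  have := (edgeDenom_pos hu hρ).ne'
  exact ContinuousAt.continuousWithinAt (by fun_prop (disch := assumption))

lemma edgeProfile_pos {u : ℝ} (hu : -1 / 9 < u) : 0 < edgeProfile u :=
  intervalIntegral.intervalIntegral_pos_of_pos_on
    (intervalIntegrable_unit (edgeProfile_integrand_continuousOn hu))
    (fun _ hρ => one_div_pos.2 (edgeDenom_pos hu (Ioo_subset_Icc_self hρ))) zero_lt_one

lemma arcDenom_pos {u y : ℝ} (hu : -1 / 9 < u) (hy : y ∈ Icc (0 : ℝ) 1) :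
    0 < 1 + 9 * u - 6 * u * y ^ 2 := by
  obtain ⟨h1, h2⟩ := sq_mem_unit hy
  have := one_add_mul_pos hu (c := 9 - 6 * y ^ 2) (by linarith) (by linarith)
  linarith

/-- The substitution `y = √(1 + 9 * u) * ρ / √(1 + 3 * u + 6 * u * ρ ^ 2)` maps `[0, 1]` onto itself
for every `u`. Unlike the original integrand with its prefactor, the new one is compared pointwise
in `u` at once. -/
lemma edgeProfile_eq_arc {u : ℝ} (hu : -1 / 9 < u) :
    √((1 + 3 * u) * (1 + 9 * u)) * edgeProfile u =
      ∫ y in 0..1, √((1 + 9 * u) / (1 + 9 * u - 6 * u * y ^ 2)) := by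
  have h3 : 0 < 1 + 3 * u := by linarith
  have h9 : 0 < 1 + 9 * u := by linarith
  have hd : ∀ ρ ∈ Icc (0 : ℝ) 1, HasDerivAt
      (fun ρ => √(1 + 9 * u) * (ρ / √(1 + 3 * u + 6 * u * ρ ^ 2)))
      (√(1 + 9 * u) * ((1 + 3 * u) / ((1 + 3 * u + 6 * u * ρ ^ 2) *
        √(1 + 3 * u + 6 * u * ρ ^ 2)))) ρ := fun ρ hρ =>
    (hasDerivAt_div_sqrt (edgeDenom_pos hu hρ)).const_mul _
  have key := intervalIntegral.integral_comp_mul_deriv_of_deriv_nonneg (a := 0) (b := 1)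
    (g := fun y => √((1 + 9 * u) / (1 + 9 * u - 6 * u * y ^ 2)))
    (fun ρ hρ => (hd ρ (by rwa [uIcc_of_le zero_le_one] at hρ)).continuousAt.continuousWithinAt)
    (fun ρ hρ => hd ρ (Ioo_subset_Icc_self (by simpa using hρ)))
    (fun ρ hρ => by
      have := edgeDenom_pos hu (Ioo_subset_Icc_self (by simpa using hρ : ρ ∈ Ioo (0 : ℝ) 1))
      positivity)
  have h1 : √(1 + 9 * u) * (1 / √(1 + 3 * u + 6 * u * 1 ^ 2)) = 1 := by
    rw [show 1 + 3 * u + 6 * u * 1 ^ 2 = 1 + 9 * u by ring]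
    have := (Real.sqrt_pos.2 h9).ne'
    field_simp
  rw [h1, zero_div, mul_zero] at key
  rw [← key, edgeProfile, ← intervalIntegral.integral_const_mul]
  refine intervalIntegral_unit_congr fun ρ hρ => ?_
  have hB := edgeDenom_pos hu hρ
  simp only [Function.comp_apply]
  rw [mul_pow, div_pow, Real.sq_sqrt h9.le, Real.sq_sqrt hB.le,
    show (1 + 9 * u) / (1 + 9 * u - 6 * u * ((1 + 9 * u) * (ρ ^ 2 / (1 + 3 * u + 6 * u * ρ ^ 2)))) =
      (1 + 3 * u + 6 * u * ρ ^ 2) / (1 + 3 * u) by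
    rw [show 1 + 9 * u - 6 * u * ((1 + 9 * u) * (ρ ^ 2 / (1 + 3 * u + 6 * u * ρ ^ 2))) =
      (1 + 9 * u) * ((1 + 3 * u) / (1 + 3 * u + 6 * u * ρ ^ 2)) by
      generalize hBd : 1 + 3 * u + 6 * u * ρ ^ 2 = B at *
      rw [← mul_right_inj' hB.ne', mul_sub]
      have : B * (6 * u * ((1 + 9 * u) * (ρ ^ 2 / B))) = 6 * u * ((1 + 9 * u) * ρ ^ 2) := by
        field_simp
      have h' : B * ((1 + 9 * u) * ((1 + 3 * u) / B)) = (1 + 9 * u) * (1 + 3 * u) := by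
        field_simp
      rw [this, h', ← hBd]
      ring]
    rw [div_mul_eq_div_div, div_self h9.ne', one_div_div],
    Real.sqrt_div hB.le, Real.sqrt_mul h3.le]
  have e3 : √(1 + 3 * u) ^ 2 = 1 + 3 * u := Real.sq_sqrt h3.le
  have p3 := Real.sqrt_pos.2 h3
  have pB := Real.sqrt_pos.2 hB
  nth_rewrite 4 [← e3]
  generalize √(1 + 3 * u + 6 * u * ρ ^ 2) = y at *
  generalize 1 + 3 * u + 6 * u * ρ ^ 2 = B at *
  generalize √(1 + 3 * u) = c at *
  field_simp
  rw [Real.sqrt_sq p3.le]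
  linear_combination e3

lemma arc_continuousOn {u : ℝ} (hu : -1 / 9 < u) :
    ContinuousOn (fun y => √((1 + 9 * u) / (1 + 9 * u - 6 * u * y ^ 2))) (Icc 0 1) := by
  intro y hy
  have := (arcDenom_pos hu hy).ne'
  exact ContinuousAt.continuousWithinAt (by fun_prop (disch := assumption))

lemma sqrt_mul_edgeProfile_monotoneOn :
    MonotoneOn (fun u => √((1 + 3 * u) * (1 + 9 * u)) * edgeProfile u) (Ioi (-1 / 9)) := by
  intro u hu v hv huv
  simp only [edgeProfile_eq_arc hu, edgeProfile_eq_arc hv]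
  refine intervalIntegral.integral_mono_on zero_le_one (intervalIntegrable_unit (arc_continuousOn hu))
    (intervalIntegrable_unit (arc_continuousOn hv)) fun y hy => Real.sqrt_le_sqrt ?_
  rw [div_le_div_iff₀ (arcDenom_pos hu hy) (arcDenom_pos hv hy)]
  nlinarith [mul_nonneg (sub_nonneg.2 huv) (sq_nonneg y)]

/-- Up to a constant factor, the quotient of the derivatives of the volume and of the area to the
power `3 / 2`. -/
noncomputable def slopeProfile (u : ℝ) : ℝ :=
  edgeProfile u / ((1 + u) * angleExcessDeriv u * √(areaProfile u))

lemma angleExcessDeriv_pos {u : ℝ} (hu : -1 / 9 < u) : 0 < angleExcessDeriv u := by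
  have h1 : 0 < 1 + u := by linarith
  have h9 : 0 < 1 + 9 * u := by linarith
  have h3 : 0 < 1 + 3 * u := by linarith
  unfold angleExcessDeriv
  positivity

/-- The factors are grouped so that each is monotone: the arc integral, a homographic function under
a root, and the inverse root of the decreasing `areaProfile`. -/
lemma slopeProfile_eq {u : ℝ} (hu : -1 / 9 < u) :
    slopeProfile u = 1 / (6 * √3) * (√((1 + 3 * u) * (1 + 9 * u)) * edgeProfile u) *
      √((1 + 3 * u) / (1 + u)) * (1 / √(areaProfile u)) := by
  have h1 : 0 < 1 + u := by linarith
  have h9 : 0 < 1 + 9 * u := by linarith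
  have h3 : 0 < 1 + 3 * u := by linarith
  have ha := Real.sqrt_pos.2 (areaProfile_pos hu)
  have e1 : √(1 + u) ^ 2 = 1 + u := Real.sq_sqrt h1.le
  have e3 : √(1 + 3 * u) ^ 2 = 1 + 3 * u := Real.sq_sqrt h3.le
  have p1 := Real.sqrt_pos.2 h1
  have p9 := Real.sqrt_pos.2 h9
  have p3 := Real.sqrt_pos.2 h3
  rw [slopeProfile, angleExcessDeriv, Real.sqrt_mul h3.le, Real.sqrt_mul h9.le,
    Real.sqrt_div h3.le]
  nth_rewrite 1 [← e1]
  nth_rewrite 1 [← e3]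
  generalize √(1 + u) = x at *
  generalize √(1 + 3 * u) = y at *
  generalize √(1 + 9 * u) = z at *
  field_simp

lemma slopeProfile_strictMonoOn : StrictMonoOn slopeProfile (Ioi (-1 / 9)) := by
  intro u hu v hv huv
  rw [slopeProfile_eq hu, slopeProfile_eq hv]
  have h1 := sqrt_mul_edgeProfile_monotoneOn hu hv huv.le
  have h2 := areaProfile_antitoneOn hu hv huv.le
  have pu := edgeProfile_pos hu
  have pv := edgeProfile_pos hv
  have au := areaProfile_pos hu
  have av := areaProfile_pos hv
  rw [mem_Ioi] at hu hv
  have h3 : √((1 + 3 * u) / (1 + u)) < √((1 + 3 * v) / (1 + v)) := by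
    refine Real.sqrt_lt_sqrt (div_nonneg (by linarith) (by linarith)) ?_
    rw [div_lt_div_iff₀ (by linarith) (by linarith)]
    nlinarith
  have p : 0 < √((1 + 3 * v) * (1 + 9 * v)) :=
    Real.sqrt_pos.2 (mul_pos (by linarith) (by linarith))
  simp only at h1
  calc _ ≤ 1 / (6 * √3) * (√((1 + 3 * v) * (1 + 9 * v)) * edgeProfile v) *
      √((1 + 3 * u) / (1 + u)) * (1 / √(areaProfile v)) := by gcongr
    _ < _ := by gcongr

/-! ### Volume at unit face area -/

/-- The volume of a regular tetrahedron with faces of unit area, as a function of the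
curvature. -/
noncomputable def unitAreaVolume (ε : ℝ) : ℝ :=
  12 * √3 * ∫ y in 0..1, √y * slopeProfile (excessInverse (y * ε))

lemma hasDerivAt_sq_mul_areaProfile {u τ : ℝ} (hu : -1 / 9 < u) (hτ : τ ∈ Icc (0 : ℝ) 1) :
    HasDerivAt (fun τ => τ ^ 2 * areaProfile (u * τ ^ 2))
      (2 * τ * angleExcessDeriv (u * τ ^ 2)) τ := by
  have hu' := mul_sq_gt hu hτ
  -- Gauss–Bonnet gives the function as `angleExcess (u * τ ^ 2) / u` only for `u ≠ 0`. In the flat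
  -- case both profiles equal `6 * √3`.
  rcases eq_or_ne u 0 with rfl | h0
  · simp only [zero_mul, areaProfile_zero, angleExcessDeriv_zero]
    simpa using (hasDerivAt_pow 2 τ).mul_const (6 * √3)
  · have h1 : HasDerivAt (fun τ => angleExcess (u * τ ^ 2) / u)
        (2 * τ * angleExcessDeriv (u * τ ^ 2)) τ := by
      have := ((hasDerivAt_angleExcess hu').comp τ ((hasDerivAt_pow 2 τ).const_mul u)).div_const u
      refine this.congr_deriv ?_
      field_simp
      push_cast
      ring
    refine h1.congr_of_eventuallyEq ?_
    have : ∀ᶠ σ in nhds τ, -1 / 9 < u * σ ^ 2 :=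
      (by fun_prop : ContinuousAt (fun σ => u * σ ^ 2) τ).eventually_const_lt hu'
    filter_upwards [this] with σ hσ
    rw [← mul_areaProfile hσ]
    field_simp

/-- The tetrahedron shrunk by `τ` in the chart has parameter `u * τ ^ 2`. The new variable `y` is
the ratio of its face area to the full one; by Gauss–Bonnet its excess is then `y` times the full
excess. -/
lemma volumeProfile_eq {u : ℝ} (hu : -1 / 9 < u) :
    volumeProfile u = √(areaProfile u) ^ 3 * unitAreaVolume (angleExcess u) := by
  have ha := areaProfile_pos hu
  have hd : ∀ τ ∈ Icc (0 : ℝ) 1, HasDerivAt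
      (fun τ => τ ^ 2 * areaProfile (u * τ ^ 2) / areaProfile u)
      (2 * τ * angleExcessDeriv (u * τ ^ 2) / areaProfile u) τ := fun τ hτ =>
    (hasDerivAt_sq_mul_areaProfile hu hτ).div_const _
  have key := intervalIntegral.integral_comp_mul_deriv_of_deriv_nonneg (a := 0) (b := 1)
    (g := fun y => √y * slopeProfile (excessInverse (y * angleExcess u)))
    (fun τ hτ => (hd τ (by rwa [uIcc_of_le zero_le_one] at hτ)).continuousAt.continuousWithinAt)
    (fun τ hτ => hd τ (Ioo_subset_Icc_self (by simpa using hτ)))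
    (fun τ hτ => by
      have hτ' : τ ∈ Ioo (0 : ℝ) 1 := by simpa using hτ
      have := angleExcessDeriv_pos (mul_sq_gt hu (Ioo_subset_Icc_self hτ'))
      have := hτ'.1
      positivity)
  rw [one_pow, mul_one, one_mul, div_self ha.ne', zero_pow two_ne_zero, zero_mul, zero_div] at key
  rw [unitAreaVolume, ← key, volumeProfile, ← mul_assoc, ← intervalIntegral.integral_const_mul,
    ← intervalIntegral.integral_const_mul]
  refine intervalIntegral_unit_congr fun τ hτ => ?_
  have hv := mul_sq_gt hu hτ
  have hav := areaProfile_pos hv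
  simp only [Function.comp_apply]
  rw [show τ ^ 2 * areaProfile (u * τ ^ 2) / areaProfile u * angleExcess u =
      angleExcess (u * τ ^ 2) by
    rw [← mul_areaProfile hu, ← mul_areaProfile hv]; field_simp,
    excessInverse_angleExcess hv, slopeProfile, Real.sqrt_div (by positivity),
    Real.sqrt_mul (by positivity), Real.sqrt_sq hτ.1]
  have e := Real.sq_sqrt ha.le
  have p := Real.sqrt_pos.2 ha
  have pv := Real.sqrt_pos.2 hav
  have h1 : 0 < 1 + u * τ ^ 2 := by linarith
  have he := angleExcessDeriv_pos hv
  generalize angleExcessDeriv (u * τ ^ 2) = d at *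
  generalize edgeProfile (u * τ ^ 2) = j at *
  generalize √(areaProfile (u * τ ^ 2)) = z at *
  generalize √(areaProfile u) = x at *
  rw [← e]
  generalize 1 + u * τ ^ 2 = w at *
  field_simp
  ring

lemma mul_mem_excess {y ε : ℝ} (hy : y ∈ Icc (0 : ℝ) 1) (hε : ε ∈ Ioo (-π) π) :
    y * ε ∈ Ioo (-π) π := by
  rw [mem_Ioo, ← abs_lt] at hε ⊢
  rw [abs_mul, abs_of_nonneg hy.1]
  exact (mul_le_of_le_one_left (abs_nonneg ε) hy.2).trans_lt hε

lemma slope_comp_strictMonoOn :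
    StrictMonoOn (fun ε => slopeProfile (excessInverse ε)) (Ioo (-π) π) := fun _ hε _ hδ h =>
  slopeProfile_strictMonoOn (excessInverse_spec hε).1 (excessInverse_spec hδ).1
    (excessInverse_strictMonoOn hε hδ h)

/-- Monotonicity of the slope in `y`, in a direction given by the sign of `ε`, suffices; its
continuity is not needed. -/
lemma unitAreaVolume_integrable {ε : ℝ} (hε : ε ∈ Ioo (-π) π) :
    IntervalIntegrable (fun y => √y * slopeProfile (excessInverse (y * ε))) volume 0 1 := by
  refine IntervalIntegrable.continuousOn_mul ?_ (by fun_prop)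
  rcases le_total 0 ε with h | h
  · refine MonotoneOn.intervalIntegrable fun x hx y hy hxy => ?_
    rw [uIcc_of_le zero_le_one] at hx hy
    exact slope_comp_strictMonoOn.monotoneOn (mul_mem_excess hx hε) (mul_mem_excess hy hε)
      (mul_le_mul_of_nonneg_right hxy h)
  · refine AntitoneOn.intervalIntegrable fun x hx y hy hxy => ?_
    rw [uIcc_of_le zero_le_one] at hx hy
    exact slope_comp_strictMonoOn.monotoneOn (mul_mem_excess hy hε) (mul_mem_excess hx hε)
      (mul_le_mul_of_nonpos_right hxy h)

lemma unitAreaVolume_strictMonoOn : StrictMonoOn unitAreaVolume (Ioo (-π) π) := by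
  intro ε hε δ hδ h
  refine mul_lt_mul_of_pos_left ?_ (by positivity)
  rw [← sub_pos, ← intervalIntegral.integral_sub (unitAreaVolume_integrable hδ)
    (unitAreaVolume_integrable hε)]
  refine intervalIntegral.intervalIntegral_pos_of_pos_on
    ((unitAreaVolume_integrable hδ).sub (unitAreaVolume_integrable hε)) (fun y hy => ?_) zero_lt_one
  have hy' := Ioo_subset_Icc_self hy
  rw [← mul_sub]
  exact mul_pos (Real.sqrt_pos.2 hy.1) (sub_pos.2 (slope_comp_strictMonoOn (mul_mem_excess hy' hε)
    (mul_mem_excess hy' hδ) (mul_lt_mul_of_pos_left h hy.1)))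

/-! ### Edge length and face area as parameters -/

lemma mem_chartEdges {R s : ℝ} :
    s ∈ chartEdges R ↔ 0 < s ∧ -1 / 9 < R / 6 * (s ^ 2 / 24) := by
  have h : ∀ i, ‖tetraVertex s i‖ ^ 2 = 9 * (s ^ 2 / 24) := fun i => by
    rw [← real_inner_self_eq_norm_sq, isRegularVertices_tetraVertex s i i, if_pos rfl]; ring
  simp only [chartEdges, kleinChart, mem_ofPred_eq, h, forall_const]
  refine and_congr_right fun _ => ?_
  constructor <;> intro h <;> linarith

lemma geodesicEdge_eq {R s : ℝ} (hs : s ∈ chartEdges R) :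
    geodesicEdge R s = s * √(1 + 3 * (R / 6 * (s ^ 2 / 24))) *
      edgeProfile (R / 6 * (s ^ 2 / 24)) := by
  obtain ⟨h0, hu⟩ := mem_chartEdges.1 hs
  have e : ![tetraVertex s 0, tetraVertex s 1] = tetraVertex s ∘ ![0, 1] := by
    funext i; fin_cases i <;> rfl
  rw [geodesicEdge, e]
  exact ((isRegularVertices_tetraVertex s).comp (by decide)).length_eq h0.le rfl hu

/-- The edge is rescaled to the chart coordinate centred at its own midpoint, at squared distance `3
* s ^ 2 / 24` from the origin. The integrand then no longer involves `s`; only the upper limit does.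
-/
lemma geodesicEdge_eq_integral {R s : ℝ} (hs : s ∈ chartEdges R) :
    geodesicEdge R s =
      2 * ∫ η in 0..s / (2 * √(1 + 3 * (R / 6 * (s ^ 2 / 24)))), 1 / (1 + R / 6 * η ^ 2) := by
  obtain ⟨h0, hu⟩ := mem_chartEdges.1 hs
  rw [geodesicEdge_eq hs, edgeProfile]
  set u := R / 6 * (s ^ 2 / 24) with hud
  have hb : 0 < 1 + 3 * u := by linarith
  have pb := Real.sqrt_pos.2 hb
  have eb : √(1 + 3 * u) ^ 2 = 1 + 3 * u := Real.sq_sqrt hb.le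
  have hc : 0 < s / (2 * √(1 + 3 * u)) := by positivity
  have h := intervalIntegral.integral_comp_mul_left (a := 0) (b := 1)
    (fun η => 1 / (1 + R / 6 * η ^ 2)) hc.ne'
  rw [mul_zero, mul_one, smul_eq_mul, eq_inv_mul_iff_mul_eq₀ hc.ne'] at h
  rw [← h, ← intervalIntegral.integral_const_mul, ← intervalIntegral.integral_const_mul,
    ← intervalIntegral.integral_const_mul]
  refine intervalIntegral_unit_congr fun ρ hρ => ?_
  have hB := edgeDenom_pos hu hρ
  rw [show 1 + R / 6 * (s / (2 * √(1 + 3 * u)) * ρ) ^ 2 =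
      (1 + 3 * u + 6 * u * ρ ^ 2) / √(1 + 3 * u) ^ 2 by
    rw [eq_div_iff (by positivity), add_mul, one_mul, eb, mul_pow, div_pow, mul_pow, eb]
    rw [← div_div, mul_assoc, mul_right_comm, div_mul_cancel₀ _ hb.ne', hud]
    ring]
  generalize 1 + 3 * u + 6 * u * ρ ^ 2 = B at *
  generalize √(1 + 3 * u) = y at *
  field_simp

lemma geodesicEdge_strictMonoOn (R : ℝ) : StrictMonoOn (geodesicEdge R) (chartEdges R) := by
  intro s hs t ht hst
  rw [geodesicEdge_eq_integral hs, geodesicEdge_eq_integral ht]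
  obtain ⟨hs0, hsu⟩ := mem_chartEdges.1 hs
  obtain ⟨ht0, htu⟩ := mem_chartEdges.1 ht
  have hbs : 0 < 1 + 3 * (R / 6 * (s ^ 2 / 24)) := by linarith
  have hbt : 0 < 1 + 3 * (R / 6 * (t ^ 2 / 24)) := by linarith
  have ebt : √(1 + 3 * (R / 6 * (t ^ 2 / 24))) ^ 2 = _ := Real.sq_sqrt hbt.le
  have ebs : √(1 + 3 * (R / 6 * (s ^ 2 / 24))) ^ 2 = _ := Real.sq_sqrt hbs.le
  have pbs := Real.sqrt_pos.2 hbs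
  have pbt := Real.sqrt_pos.2 hbt
  -- After squaring and cross-multiplying, the curvature terms cancel and `s ^ 2 < t ^ 2` remains.
  have hlt : s / (2 * √(1 + 3 * (R / 6 * (s ^ 2 / 24)))) <
      t / (2 * √(1 + 3 * (R / 6 * (t ^ 2 / 24)))) := by
    rw [div_lt_div_iff₀ (by positivity) (by positivity)]
    refine lt_of_pow_lt_pow_left₀ 2 (by positivity) ?_
    rw [mul_pow, mul_pow, mul_pow, mul_pow, ebt, ebs]
    nlinarith
  have hpos : ∀ η ∈ Icc 0 (t / (2 * √(1 + 3 * (R / 6 * (t ^ 2 / 24))))),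
      0 < 1 + R / 6 * η ^ 2 := by
    intro η hη
    have h2 : η ^ 2 * (4 * (1 + 3 * (R / 6 * (t ^ 2 / 24)))) ≤ t ^ 2 := by
      have := pow_le_pow_left₀ hη.1 hη.2 2
      rwa [div_pow, mul_pow, ebt, le_div_iff₀ (by positivity), show (2 : ℝ) ^ 2 = 4 by norm_num]
        at this
    rcases le_total 0 R with h | h
    · positivity
    · have : 0 < (1 + R / 6 * η ^ 2) * (4 * (1 + 3 * (R / 6 * (t ^ 2 / 24)))) := by
        nlinarith [mul_le_mul_of_nonpos_left h2 (by linarith : R / 6 ≤ 0)]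
      exact pos_of_mul_pos_left this (by positivity)
  have hc : ContinuousOn (fun η => 1 / (1 + R / 6 * η ^ 2))
      (Icc 0 (t / (2 * √(1 + 3 * (R / 6 * (t ^ 2 / 24)))))) := by
    intro η hη
    have := (hpos η hη).ne'
    exact ContinuousAt.continuousWithinAt (by fun_prop (disch := assumption))
  have h0 : 0 ≤ s / (2 * √(1 + 3 * (R / 6 * (s ^ 2 / 24)))) := by positivity
  refine mul_lt_mul_of_pos_left ?_ two_pos
  have i1 := (hc.mono (Icc_subset_Icc_right hlt.le)).intervalIntegrable_of_Icc
    (μ := volume) h0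
  have i2 := (hc.mono (Icc_subset_Icc_left h0)).intervalIntegrable_of_Icc (μ := volume) hlt.le
  rw [← intervalIntegral.integral_add_adjacent_intervals i1 i2]
  exact lt_add_of_pos_right _ (intervalIntegral.intervalIntegral_pos_of_pos_on i2
    (fun η hη => one_div_pos.2 (hpos η ⟨h0.trans hη.1.le, hη.2.le⟩)) hlt)

lemma chartEdge_geodesicEdge {R s : ℝ} (hs : s ∈ chartEdges R) :
    chartEdge R (geodesicEdge R s) = s :=
  (geodesicEdge_strictMonoOn R).injOn.leftInvOn_invFunOn hs

lemma tetraFaceArea_geodesicEdge {R s : ℝ} (hs : s ∈ chartEdges R) :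
    tetraFaceArea R (geodesicEdge R s) = s ^ 2 / 24 * areaProfile (R / 6 * (s ^ 2 / 24)) := by
  have e : ![tetraVertex s 0, tetraVertex s 1, tetraVertex s 2] = tetraVertex s ∘ ![0, 1, 2] := by
    funext i; fin_cases i <;> rfl
  rw [tetraFaceArea, chartEdge_geodesicEdge hs, e]
  exact ((isRegularVertices_tetraVertex s).comp (by decide)).area_eq rfl (mem_chartEdges.1 hs).2

lemma tetraVolume_geodesicEdge {R s : ℝ} (hs : s ∈ chartEdges R) :
    tetraVolume R (geodesicEdge R s) =
      √(s ^ 2 / 24) ^ 3 * volumeProfile (R / 6 * (s ^ 2 / 24)) := by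
  rw [tetraVolume, chartEdge_geodesicEdge hs]
  exact (isRegularVertices_tetraVertex s).volume_eq (mem_chartEdges.1 hs).1.le rfl
    (mem_chartEdges.1 hs).2

lemma angleExcess_eq_mul_area {R s : ℝ} (hs : s ∈ chartEdges R) :
    angleExcess (R / 6 * (s ^ 2 / 24)) = R / 6 * tetraFaceArea R (geodesicEdge R s) := by
  rw [tetraFaceArea_geodesicEdge hs, ← mul_areaProfile (mem_chartEdges.1 hs).2, mul_assoc]

lemma excess_mem_iff {R A : ℝ} (hA : 0 < A) : R / 6 * A ∈ Ioo (-π) π ↔ |R| * A < 6 * π := by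
  rw [mem_Ioo, ← abs_lt, abs_mul, abs_div, abs_of_pos hA, abs_of_pos (by norm_num : (0 : ℝ) < 6)]
  constructor <;> intro h <;> linarith

lemma tetraFaceArea_bijOn (R : ℝ) :
    BijOn (tetraFaceArea R) (edgeLengths R) {A : ℝ | 0 < A ∧ |R| * A < 6 * π} := by
  refine ⟨?_, ?_, ?_⟩
  · rintro _ ⟨s, hs, rfl⟩
    obtain ⟨h0, hu⟩ := mem_chartEdges.1 hs
    have hA : 0 < tetraFaceArea R (geodesicEdge R s) := by
      rw [tetraFaceArea_geodesicEdge hs]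
      have := areaProfile_pos hu
      positivity
    refine ⟨hA, (excess_mem_iff hA).1 ?_⟩
    rw [← angleExcess_eq_mul_area hs]
    exact angleExcess_mem hu
  · rintro _ ⟨s, hs, rfl⟩ _ ⟨t, ht, rfl⟩ h
    obtain ⟨hs0, hsu⟩ := mem_chartEdges.1 hs
    obtain ⟨ht0, htu⟩ := mem_chartEdges.1 ht
    have h1 := angleExcess_eq_mul_area hs
    rw [h, ← angleExcess_eq_mul_area ht] at h1
    -- Equal areas give equal `u`, which in the flat case carries no information; the scale `s` is
    -- recovered from the area itself.
    have h2 := angleExcess_strictMonoOn.injOn hsu htu h1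
    rw [tetraFaceArea_geodesicEdge hs, tetraFaceArea_geodesicEdge ht, h2] at h
    have h3 := mul_right_cancel₀ (areaProfile_pos htu).ne' h
    rw [div_left_inj' (by norm_num)] at h3
    rw [(pow_left_inj₀ hs0.le ht0.le two_ne_zero).1 h3]
  · rintro A ⟨hA, hR⟩
    obtain ⟨hu, he⟩ := excessInverse_spec ((excess_mem_iff hA).2 hR)
    set u := excessInverse (R / 6 * A) with hud
    have ha := areaProfile_pos hu
    have hη : 0 < A / areaProfile u := by positivity
    -- The excess fixes `u`, and the squared inradius must then be `A / areaProfile u`. This choice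
    -- also covers `R = 0`.
    have e : √(24 * (A / areaProfile u)) ^ 2 / 24 = A / areaProfile u := by
      rw [Real.sq_sqrt (by positivity)]; ring
    have eu : R / 6 * (√(24 * (A / areaProfile u)) ^ 2 / 24) = u := by
      rw [e, ← mul_div_assoc, ← he, ← mul_areaProfile hu, mul_div_cancel_right₀ _ ha.ne']
    have hs : √(24 * (A / areaProfile u)) ∈ chartEdges R :=
      mem_chartEdges.2 ⟨by positivity, by rwa [eu]⟩
    refine ⟨_, ⟨_, hs, rfl⟩, ?_⟩
    rw [tetraFaceArea_geodesicEdge hs, eu, e, div_mul_cancel₀ _ ha.ne']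

/-- The scaling law: at fixed area all dependence on the curvature passes through the excess `R / 6
* A`. -/
lemma tetraVolumeOfArea_eq {R A : ℝ} (hA : 0 < A) (hR : |R| * A < 6 * π) :
    tetraVolumeOfArea R A = √A ^ 3 * unitAreaVolume (R / 6 * A) := by
  have hex : ∃ a ∈ edgeLengths R, tetraFaceArea R a = A :=
    (tetraFaceArea_bijOn R).surjOn ⟨hA, hR⟩
  have hmem := Function.invFunOn_mem hex
  have heq : tetraFaceArea R (edgeOfArea R A) = A := Function.invFunOn_eq hex
  obtain ⟨s, hs, hsa⟩ : edgeOfArea R A ∈ edgeLengths R := hmem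
  rw [← hsa] at heq
  rw [tetraVolumeOfArea, ← hsa, tetraVolume_geodesicEdge hs,
    volumeProfile_eq (mem_chartEdges.1 hs).2, angleExcess_eq_mul_area hs, heq, ← mul_assoc,
    ← mul_pow, ← Real.sqrt_mul (by positivity), ← tetraFaceArea_geodesicEdge hs, heq]

/-! ### Comparison with the half-sphere -/

lemma kleinDensity_single {K : ℝ} {x : EuclideanSpace ℝ (Fin 3)} (h : 0 < 1 + K * ‖x‖ ^ 2) :
    kleinDensity K x (fun i : Fin 3 => EuclideanSpace.single i (1 : ℝ)) =
      1 / (1 + K * ‖x‖ ^ 2) ^ 2 := by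
  have hn : ‖x‖ ^ 2 = x 0 ^ 2 + x 1 ^ 2 + x 2 ^ 2 := by
    rw [EuclideanSpace.real_norm_sq_eq, Fin.sum_univ_three]
  rw [kleinDensity]
  simp only [kleinMetric, Matrix.det_fin_three, Matrix.of_apply, EuclideanSpace.inner_single_right,
    PiLp.single_apply]
  generalize hw : 1 + K * ‖x‖ ^ 2 = w at *
  rw [hn] at hw
  rw [show 1 / w ^ 2 = √((1 / w ^ 2) ^ 2) by rw [Real.sqrt_sq (by positivity)]]
  congr 1
  simp
  field_simp
  rw [← hw]
  ring

lemma kleinChartVolume_eq {K : ℝ} (hK : 0 < K) :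
    kleinChartVolume K = ∫ x : EuclideanSpace ℝ (Fin 3), 1 / (1 + K * ‖x‖ ^ 2) ^ 2 := by
  have : kleinChart K = univ := by
    ext x; simp only [kleinChart, mem_ofPred_eq, mem_univ, iff_true]; positivity
  rw [kleinChartVolume, this, setIntegral_univ]
  exact integral_congr_ae (Filter.Eventually.of_forall fun x =>
    kleinDensity_single (by positivity))

lemma kleinChartVolume_scaling {K : ℝ} (hK : 0 < K) :
    kleinChartVolume K = (√K ^ 3)⁻¹ * kleinChartVolume 1 := by
  have h := Measure.integral_comp_smul (volume : Measure (EuclideanSpace ℝ (Fin 3)))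
    (fun x => 1 / (1 + 1 * ‖x‖ ^ 2) ^ 2) √K
  rw [finrank_euclideanSpace_fin, abs_of_pos (by positivity), smul_eq_mul] at h
  rw [kleinChartVolume_eq hK, kleinChartVolume_eq one_pos, ← h]
  simp only [norm_smul, mul_pow, Real.norm_eq_abs, sq_abs, Real.sq_sqrt hK.le, one_mul]

/-- The density decays like `‖x‖ ^ (-4)`, faster than the dimension three requires. -/
lemma integrable_chartDensity {K : ℝ} (hK : 0 < K) :
    Integrable fun x : EuclideanSpace ℝ (Fin 3) => 1 / (1 + K * ‖x‖ ^ 2) ^ 2 := by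
  have h : Integrable fun x : EuclideanSpace ℝ (Fin 3) => 1 / (1 + ‖x‖ ^ 2) ^ 2 := by
    refine (integrable_rpow_neg_one_add_norm_sq (E := EuclideanSpace ℝ (Fin 3)) (r := 4)
      (by rw [finrank_euclideanSpace_fin]; norm_num)).congr
      (Filter.Eventually.of_forall fun x => ?_)
    simp only
    rw [show (-4 : ℝ) / 2 = -(2 : ℕ) by norm_num, Real.rpow_neg (by positivity),
      Real.rpow_natCast, one_div]
  have h2 := h.comp_smul (Real.sqrt_pos.2 hK).ne'
  simpa only [norm_smul, mul_pow, Real.norm_eq_abs, sq_abs, Real.sq_sqrt hK.le] using h2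

/-- The matrix whose columns are the edge vectors of the tetrahedron at its first vertex. -/
noncomputable def edgeMatrix (s : ℝ) : Matrix (Fin 3) (Fin 3) ℝ :=
  Matrix.of fun i j => (tetraVertex s j.succ - tetraVertex s 0) i

lemma det_edgeMatrix (s : ℝ) : (edgeMatrix s).det = s ^ 3 / √2 := by
  have h6 : √(6 : ℝ) = √2 * √3 := by rw [← Real.sqrt_mul (by norm_num)]; norm_num
  have h2 : √2 ^ 2 = (2 : ℝ) := Real.sq_sqrt (by norm_num)
  have h3 : √3 ^ 2 = (3 : ℝ) := Real.sq_sqrt (by norm_num)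
  have : √(2 : ℝ) ≠ 0 := by positivity
  rw [eq_div_iff this]
  simp [edgeMatrix, Matrix.det_fin_three, tetraVertex, Fin.succ, h6]
  ring_nf
  simp only [h2, h3]
  ring

lemma simplexPoint_eq_toLp (s : ℝ) (t : Fin 3 → ℝ) :
    tetraVertex s 0 + ∑ i : Fin 3, t i • (tetraVertex s i.succ - tetraVertex s 0) =
      WithLp.toLp 2 ((edgeMatrix s).toLin' t + (tetraVertex s 0).ofLp) := by
  ext i
  simp [edgeMatrix, Matrix.mulVec, dotProduct, Fin.sum_univ_three]
  ring

lemma integral_simplexPoint {s : ℝ} (hs : 0 < s) {G : EuclideanSpace ℝ (Fin 3) → ℝ}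
    (hG : Integrable G) :
    Integrable (fun t : Fin 3 → ℝ => G (tetraVertex s 0 +
      ∑ i : Fin 3, t i • (tetraVertex s i.succ - tetraVertex s 0))) ∧
    s ^ 3 / √2 * ∫ t : Fin 3 → ℝ, G (tetraVertex s 0 +
      ∑ i : Fin 3, t i • (tetraVertex s i.succ - tetraVertex s 0)) = ∫ x, G x := by
  have hdet : 0 < (edgeMatrix s).det := by rw [det_edgeMatrix]; positivity
  have mp := PiLp.volume_preserving_toLp (Fin 3)
  have emb := (MeasurableEquiv.toLp 2 (Fin 3 → ℝ)).measurableEmbedding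
  set c := (tetraVertex s 0).ofLp
  set g : (Fin 3 → ℝ) → ℝ := fun y => G (WithLp.toLp 2 (y + c)) with hg
  have gi : Integrable g := by
    have : Integrable fun y : Fin 3 → ℝ => G (WithLp.toLp 2 y) :=
      (mp.integrable_comp_emb emb).2 hG
    exact this.comp_add_right c
  have ge : ∫ y, g y = ∫ x, G x := by
    rw [hg, integral_add_right_eq_self (fun y => G (WithLp.toLp 2 y)) c]
    exact mp.integral_comp emb G
  have hm := Real.map_matrix_volume_pi_eq_smul_volume_pi hdet.ne'
  have lemb : MeasurableEmbedding (edgeMatrix s).toLin' :=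
    (LinearEquiv.ofIsUnitDet (f := (edgeMatrix s).toLin')
      (v := Pi.basisFun ℝ (Fin 3)) (v' := Pi.basisFun ℝ (Fin 3)) (by
        simpa [LinearMap.toMatrix_eq_toMatrix'] using hdet.ne')
      ).toContinuousLinearEquiv.toHomeomorph.measurableEmbedding
  simp only [simplexPoint_eq_toLp]
  constructor
  · have : Integrable g (Measure.map (edgeMatrix s).toLin' volume) := by
      rw [hm]; exact gi.smul_measure ENNReal.ofReal_ne_top
    exact lemb.integrable_map_iff.1 this
  · have h := lemb.integral_map (μ := volume) g
    rw [hm, integral_smul_measure, ENNReal.toReal_ofReal (abs_nonneg _), smul_eq_mul, ge,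
      abs_of_pos (inv_pos.2 hdet), inv_mul_eq_iff_eq_mul₀ hdet.ne', det_edgeMatrix] at h
    exact h.symm

/-- Both sides integrate the same positive density, the left one over a subset of the chart. -/
lemma geodesicSimplexVolume_tetra_le {K s : ℝ} (hK : 0 < K) (hs : 0 < s) :
    geodesicSimplexVolume K (tetraVertex s) ≤ kleinChartVolume K := by
  have hp := isRegularVertices_tetraVertex s
  have hu : -1 / 9 < K * (s ^ 2 / 24) := by
    have : 0 < K * (s ^ 2 / 24) := by positivity
    linarith
  obtain ⟨hi, he⟩ := integral_simplexPoint hs (integrable_chartDensity hK)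
  rw [kleinChartVolume_eq hK, ← he, ← integral_const_mul, geodesicSimplexVolume]
  have hi' := hi.const_mul (s ^ 3 / √2)
  refine le_trans (le_of_eq ?_) (setIntegral_le_integral (s := parameterSimplex 3) hi'
    (Filter.Eventually.of_forall fun t => ?_))
  · refine setIntegral_congr_fun (isClosed_parameterSimplex 3).measurableSet fun t ht => ?_
    rw [hp.kleinDensity_three hs.le rfl (weight_pos_of_mem le_rfl hu ht), simplexPoint_eq_sum,
      hp.norm_sq_point]
    congr 3
    ring
  · simp only [Pi.zero_apply]
    positivity

lemma unitAreaVolume_le {ε : ℝ} (h0 : 0 < ε) (hπ : ε < π) :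
    unitAreaVolume ε ≤ (√ε ^ 3)⁻¹ * kleinChartVolume 1 := by
  obtain ⟨hu, he⟩ := excessInverse_spec (ε := ε) ⟨by linarith, hπ⟩
  set u := excessInverse ε
  have hu0 : 0 < u := by
    rw [← angleExcess_strictMonoOn.lt_iff_lt (by norm_num) hu, angleExcess_zero, he]
    exact h0
  have ha := areaProfile_pos hu
  have e24 : √(24 : ℝ) ^ 2 / 24 = 1 := by rw [Real.sq_sqrt (by norm_num)]; norm_num
  -- The edge `√24` makes the inradius `1`, so that the sectional curvature is `u` itself.
  have h := geodesicSimplexVolume_tetra_le hu0 (s := √24) (by positivity)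
  rw [(isRegularVertices_tetraVertex √24).volume_eq (u := u) (by positivity)
    (by rw [e24, mul_one]) hu, e24, Real.sqrt_one, one_pow, one_mul, volumeProfile_eq hu, he,
    kleinChartVolume_scaling hu0] at h
  rw [show √ε = √(u * areaProfile u) by rw [mul_areaProfile hu, he], Real.sqrt_mul hu0.le,
    mul_pow, mul_inv, mul_assoc,
    mul_left_comm, le_inv_mul_iff₀ (by positivity)]
  exact h

lemma unitAreaVolume_lt {ε : ℝ} (hε : ε ∈ Ioo (-π) π) :
    unitAreaVolume ε < (√π ^ 3)⁻¹ * kleinChartVolume 1 := by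
  -- The intermediate `δ` keeps the inequality strict in the limit; it is taken positive because the
  -- half-sphere bound needs positive curvature.
  obtain ⟨δ, h1, h2⟩ := exists_between (max_lt hε.2 Real.pi_pos)
  have hδε : ε < δ := (le_max_left _ _).trans_lt h1
  have hδ0 : 0 < δ := (le_max_right _ _).trans_lt h1
  have hδ : δ ∈ Ioo (-π) π := ⟨by linarith, h2⟩
  refine (unitAreaVolume_strictMonoOn hε hδ hδε).trans_le ?_
  have hc : ContinuousAt (fun x : ℝ => (√x ^ 3)⁻¹ * kleinChartVolume 1) π := by
    have : √π ^ 3 ≠ 0 := by positivity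
    fun_prop (disch := assumption)
  refine ge_of_tendsto (hc.tendsto.mono_left (nhdsWithin_le_nhds (s := Iio π))) ?_
  filter_upwards [Ioo_mem_nhdsLT h2] with x hx
  refine (unitAreaVolume_strictMonoOn hδ ⟨by linarith [hx.1], hx.2⟩ hx.1).le.trans ?_
  exact unitAreaVolume_le (hδ0.trans hx.1) hx.2

theorem mainTheorem6 :
    (∀ R : ℝ, Set.InjOn (geodesicEdge R) (chartEdges R)) ∧
    (∀ R : ℝ, Set.BijOn (tetraFaceArea R) (edgeLengths R)
      {A : ℝ | 0 < A ∧ |R| * A < 6 * Real.pi}) ∧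
    (∀ A : ℝ, 0 < A →
      (∀ R₁ R₂ : ℝ, |R₁| * A < 6 * Real.pi → |R₂| * A < 6 * Real.pi → R₁ < R₂ →
        tetraVolumeOfArea R₁ A < tetraVolumeOfArea R₂ A) ∧
      (∀ R : ℝ, |R| * A < 6 * Real.pi →
        tetraVolumeOfArea R A < kleinChartVolume (Real.pi / A))) := by
  refine ⟨fun R => (geodesicEdge_strictMonoOn R).injOn, tetraFaceArea_bijOn, fun A hA => ⟨?_, ?_⟩⟩
  · intro R₁ R₂ h₁ h₂ h
    rw [tetraVolumeOfArea_eq hA h₁, tetraVolumeOfArea_eq hA h₂]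
    refine mul_lt_mul_of_pos_left (unitAreaVolume_strictMonoOn ((excess_mem_iff hA).2 h₁)
      ((excess_mem_iff hA).2 h₂) ?_) (by positivity)
    gcongr
  · intro R h
    rw [tetraVolumeOfArea_eq hA h, kleinChartVolume_scaling (by positivity),
      Real.sqrt_div Real.pi_pos.le, div_pow, inv_div, div_eq_mul_inv (√A ^ 3), mul_assoc (√A ^ 3)]
    exact mul_lt_mul_of_pos_left (unitAreaVolume_lt ((excess_mem_iff hA).2 h)) (by positivity)
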